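/- Let $\mathbb H$ be the quaternions, regarded as a complex vector space by left multiplication, and let $\mathbf j$ be coordinatewise left multiplication by the quaternion $j$ on $\mathbb H^n$ and on $\mathbb H^\infty=\bigcup_n\mathbb H^n$ (finitely supported sequences); $\mathbf j$ is $\mathbb C$-antilinear and $\mathbf j^2=-1$. For $q\ge 0$ let $G^q_{\mathbb C}(\mathbb P_{\mathbb C}(\mathbb H^n))$ be the Grassmannian, with its usual topology, of complex linear subspaces of $\mathbb H^n$ of complex codimension $q$, and let $$G^q_{\mathbb C}(\mathbb P_{\mathbb C}(\mathbb H^\infty))=\varinjlim_n G^q_{\mathbb C}(\mathbb P_{\mathbb C}(\mathbb H^n))$$ with the direct limit topology, where $V\subset\mathbb H^n$ is identified with $V\oplus\mathbb H\subset\mathbb H^{n+1}$, so that a point of the limit is a subspace $W=V\oplus\mathbb H\oplus\mathbb H\oplus\cdots$ of $\mathbb H^\infty$ of codimension $q$. The group $\mathbb Z_2$ acts on this space by $W\mapsto \mathbf jW$. The universal quotient bundle $Q$ over it, with fibre $\mathbb H^\infty/W$ at $W$, carries the antilinear map $\mathbb H^\infty/W\to\mathbb H^\infty/\mathbf jW$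 induced by $\mathbf j$, whose square is $-1$. Let $X$ be a compact Hausdorff space with a continuous involution $j\colon X\to X$. A quaternionic vector bundle of complex rank $q$ over $(X,j)$ is a complex vector bundle $E\to X$ of rank $q$ with a continuous fibrewise $\mathbb C$-antilinear map $\tilde j\colon E\to E$ covering $j$ with $\tilde j^2=-1$; an isomorphism of such bundles is an isomorphism of complex vector bundles over $X$ commuting with the maps $\tilde j$. A $\mathbb Z_2$-map is a continuous map commuting with the involutions, and a $\mathbb Z_2$-homotopy is a homotopy through $\mathbb Z_2$-maps. **Theorem 11.2.** The assignment $f\mapsto f^*Q$ induces a bijection from the set of $\mathbb Z_2$-homotopy classes of $\mathbb Z_2$-maps $X\to G^q_{\mathbb C}(\mathbb P_{\mathbb C}(\mathbb H^\infty))$ to the set of isomorphism classes of quaternionic vector bundles of complex rank $q$ on $X$: the class of $f$ corresponds to the class of $E$ if and only if $E$ is isomorphic to $f^*Q$ as a quaternionic vector bundle, i.e. there is a continuous map $E\to Q$ covering $f$ which is a complex linear isomorphism on every fibre and commutes with the quaternionic structures. -/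

import Mathlib

open scoped Topology ComplexConjugate

universe u v

noncomputable section

namespace Quaternionic

/-! ### The quaternions as a complex vector space with a quaternionic structure -/

/-- The quaternions, as a (left) complex vector space: `(a, b)` stands for `a + b j` with
`a, b ∈ ℂ`. See `toQuaternion`. -/
abbrev H : Type := ℂ × ℂ

/-- The quaternion `j`. -/
def quatJ : Quaternion ℝ := ⟨0, 0, 1, 0⟩

theorem quatJ_coords : quatJ.re = 0 ∧ quatJ.imI = 0 ∧ quatJ.imJ = 1 ∧ quatJ.imK = 0 :=
  ⟨rfl, rfl, rfl, rfl⟩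

/-- The identification `(a, b) ↦ a + b j` of `H` with the real quaternion algebra. -/
def toQuaternion (h : H) : Quaternion ℝ := (h.1 : Quaternion ℝ) + (h.2 : Quaternion ℝ) * quatJ

theorem toQuaternion_coords (h : H) :
    (toQuaternion h).re = h.1.re ∧ (toQuaternion h).imI = h.1.im ∧
      (toQuaternion h).imJ = h.2.re ∧ (toQuaternion h).imK = h.2.im := by
  simp [toQuaternion, quatJ_coords]

theorem toQuaternion_bijective : Function.Bijective toQuaternion := by
  refine Function.bijective_iff_has_inverse.2
    ⟨fun x => (⟨x.re, x.imI⟩, ⟨x.imJ, x.imK⟩), fun h => ?_, fun x => ?_⟩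
  · simp [toQuaternion_coords]
  · ext <;> simp [toQuaternion_coords]

/-- Complex scalars act on `H` as left multiplication by complex numbers. -/
theorem toQuaternion_smul (c : ℂ) (h : H) :
    toQuaternion (c • h) = (c : Quaternion ℝ) * toQuaternion h := by
  ext <;> simp [toQuaternion_coords]

/-- The standard quaternionic structure on the quaternions: left multiplication by `j`, that is,
`a + b j ↦ -conj b + (conj a) j`. It is `ℂ`-antilinear. -/
def jH : H →ₛₗ[starRingEnd ℂ] H where
  toFun h := (-conj h.2, conj h.1)
  map_add' x y := by ext <;> simp [add_comm]
  map_smul' c x := by ext <;> simp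

theorem jH_jH (h : H) : jH (jH h) = -h := by
  ext <;> simp [jH]

/-- `jH` is left multiplication by the quaternion `j`. -/
theorem toQuaternion_jH (h : H) : toQuaternion (jH h) = quatJ * toQuaternion h := by
  ext <;> simp [toQuaternion_coords, quatJ_coords, jH]

/-- The quaternionic structure on `ℍⁿ`, coordinatewise left multiplication by `j`. -/
def jFin (n : ℕ) : (Fin n → H) →ₛₗ[starRingEnd ℂ] (Fin n → H) where
  toFun w k := jH (w k)
  map_add' x y := by ext1 k; simp
  map_smul' c x := by ext1 k; simp

theorem jFin_jFin {n : ℕ} (w : Fin n → H) : jFin n (jFin n w) = -w := by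
  funext k; exact jH_jH (w k)

/-- `ℍ^∞`, the union of the `ℍⁿ`: finitely supported sequences of quaternions. -/
abbrev HInf : Type := ℕ →₀ H

/-- The quaternionic structure on `ℍ^∞`, coordinatewise left multiplication by `j`. -/
def jInf : HInf →ₛₗ[starRingEnd ℂ] HInf := Finsupp.mapRange.linearMap jH

theorem jInf_jInf (w : HInf) : jInf (jInf w) = -w := by
  ext1 k; exact jH_jH (w k)

/-- The projection `ℍ^∞ → ℍⁿ` onto the first `n` coordinates; its kernel is the sum of the
remaining coordinate copies of `ℍ`. -/
def trunc (n : ℕ) : HInf →ₗ[ℂ] (Fin n → H) where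
  toFun w k := w k
  map_add' _ _ := rfl
  map_smul' _ _ := rfl

/-- The inclusion `ℍⁿ → ℍ^∞` as the first `n` coordinates. -/
def incl (n : ℕ) (w : Fin n → H) : HInf := ∑ k : Fin n, Finsupp.single (k : ℕ) (w k)

/-! ### The Grassmannians of codimension `q` complex subspaces -/

/-- `G^q_ℂ(ℙ_ℂ(ℍⁿ))`: the complex linear subspaces of complex codimension `q` in `ℍⁿ`
(equivalently, the projective linear subspaces of codimension `q` in `ℙ_ℂ(ℍⁿ)`). -/
@[ext]
structure Gr (q n : ℕ) where
  /-- the subspace -/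
  sub : Submodule ℂ (Fin n → H)
  codim : Module.finrank ℂ ((Fin n → H) ⧸ sub) = q

/-- The kernel of a linear surjection `ℍⁿ → ℂ^q`, as a point of the Grassmannian. Every point is
of this form, and two surjections have the same kernel iff they differ by an element of
`GL_q(ℂ)`. -/
def Gr.ker {q n : ℕ}
    (A : {A : (Fin n → H) →L[ℂ] (Fin q → ℂ) // Function.Surjective A}) : Gr q n :=
  ⟨LinearMap.ker (A.1 : (Fin n → H) →ₗ[ℂ] (Fin q → ℂ)), by
    rw [(LinearMap.quotKerEquivOfSurjective _ A.2).finrank_eq]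
    simp⟩

/-- The usual topology of the Grassmannian: the quotient topology of
`{linear surjections ℍⁿ → ℂ^q} / GL_q(ℂ)`. -/
instance (q n : ℕ) : TopologicalSpace (Gr q n) :=
  TopologicalSpace.coinduced Gr.ker inferInstance

/-- `G^q_ℂ(ℙ_ℂ(ℍ^∞))` as a set: the union (direct limit) over `n` of the `G^q_ℂ(ℙ_ℂ(ℍⁿ))`, where
`V ⊆ ℍⁿ` is identified with `V ⊕ ℍ ⊆ ℍⁿ⁺¹`, and hence with the subspace
`V ⊕ ℍ ⊕ ℍ ⊕ ⋯ = (trunc n)⁻¹(V)` of `ℍ^∞`, which has the same codimension `q`. -/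
@[ext]
structure GrInf (q : ℕ) where
  /-- the subspace -/
  sub : Submodule ℂ HInf
  exists_stage : ∃ (n : ℕ) (V : Gr q n), sub = V.sub.comap (trunc n)

/-- The canonical map `G^q_ℂ(ℙ_ℂ(ℍⁿ)) → G^q_ℂ(ℙ_ℂ(ℍ^∞))`. -/
def GrInf.ofStage {q : ℕ} (n : ℕ) (V : Gr q n) : GrInf q :=
  ⟨V.sub.comap (trunc n), n, V, rfl⟩

/-- The direct limit topology: a set is open iff its trace on every finite stage is open. -/
instance (q : ℕ) : TopologicalSpace (GrInf q) :=
  ⨆ n, TopologicalSpace.coinduced (GrInf.ofStage n) inferInstance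

theorem finrank_quotient_map_jFin {n : ℕ} (V : Submodule ℂ (Fin n → H)) :
    Module.finrank ℂ ((Fin n → H) ⧸ V.map (jFin n)) = Module.finrank ℂ ((Fin n → H) ⧸ V) := by
  have hinv : ∀ w, jFin n (-jFin n w) = w := fun w => by rw [map_neg, jFin_jFin, neg_neg]
  have hinv' : ∀ w, -jFin n (jFin n w) = w := fun w => by rw [jFin_jFin, neg_neg]
  let e : (Fin n → H) ≃+ (Fin n → H) :=
    { toFun := fun w => jFin n w
      invFun := fun w => -jFin n w
      left_inv := hinv'
      right_inv := hinv
      map_add' := fun x y => map_add _ x y }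
  let e' : ((Fin n → H) ⧸ V) ≃+ ((Fin n → H) ⧸ V.map (jFin n)) :=
    QuotientAddGroup.congr V.toAddSubgroup (V.map (jFin n)).toAddSubgroup e rfl
  have h := rank_eq_of_equiv_equiv (starRingEnd ℂ) e' (starRingAut (R := ℂ)).bijective (by
    rintro r ⟨m⟩
    exact congrArg (Submodule.Quotient.mk (p := V.map (jFin n))) ((jFin n).map_smulₛₗ r m))
  rw [Module.finrank, Module.finrank, h]

theorem map_jInf_comap_trunc {n : ℕ} (V : Submodule ℂ (Fin n → H)) :
    (V.comap (trunc n)).map jInf = (V.map (jFin n)).comap (trunc n) := by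
  ext w
  simp only [Submodule.mem_map, Submodule.mem_comap]
  constructor
  · rintro ⟨y, hy, rfl⟩
    exact ⟨trunc n y, hy, rfl⟩
  · rintro ⟨y, hy, hyw⟩
    refine ⟨-jInf w, ?_, by rw [map_neg, jInf_jInf, neg_neg]⟩
    have h : trunc n (jInf w) = jFin n (trunc n w) := rfl
    rw [map_neg, h, ← hyw, jFin_jFin, neg_neg]
    exact hy

/-- The involution on `G^q_ℂ(ℙ_ℂ(ℍ^∞))` induced by the quaternionic structure: `W ↦ j W`. -/
def GrInf.conj {q : ℕ} (W : GrInf q) : GrInf q :=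
  ⟨W.sub.map jInf, by
    obtain ⟨n, V, hV⟩ := W.exists_stage
    exact ⟨n, ⟨V.sub.map (jFin n), (finrank_quotient_map_jFin V.sub).trans V.codim⟩, by
      rw [hV]; exact map_jInf_comap_trunc V.sub⟩⟩

/-! ### The universal quotient bundle -/

/-- The total space of the universal quotient bundle over `G^q_ℂ(ℙ_ℂ(ℍ^∞))`, whose fibre over `W`
is the `q`-dimensional complex vector space `ℍ^∞ ⧸ W`. -/
structure UnivQuot (q : ℕ) where
  /-- the point of the base -/
  base : GrInf q
  /-- the vector in the fibre -/
  vec : HInf ⧸ base.sub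

/-- The total space of the universal quotient bundle carries the quotient topology of the trivial
bundle: a set is open iff its preimage in `G^q_ℂ(ℙ_ℂ(ℍ^∞)) × ℍⁿ` is open for every `n`. -/
instance (q : ℕ) : TopologicalSpace (UnivQuot q) :=
  ⨆ n : ℕ, TopologicalSpace.coinduced
    (fun p : GrInf q × (Fin n → H) =>
      (⟨p.1, Submodule.Quotient.mk (incl n p.2)⟩ : UnivQuot q)) inferInstance

/-- The quaternionic structure on the universal quotient bundle, covering `GrInf.conj`: the
antilinear maps `ℍ^∞ ⧸ W → ℍ^∞ ⧸ j W` induced by `j`. -/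
def UnivQuot.conj {q : ℕ} (p : UnivQuot q) : UnivQuot q :=
  ⟨p.base.conj, Submodule.mapQ p.base.sub (p.base.sub.map jInf) jInf
    (Submodule.le_comap_map _ _) p.vec⟩

/-! ### Quaternionic vector bundles -/

section Bundles

variable {X : Type u} [TopologicalSpace X]

/-- A quaternionic vector bundle of complex rank `q` over the space `X` with involution `j`: a
complex vector bundle (locally trivial with fibre `ℂ^q`) with a continuous map `J` of the total
space that covers `j`, is antilinear on the fibres and satisfies `J ∘ J = -1`. -/
structure QuatBundle (j : C(X, X)) (q : ℕ) where
  /-- the fibres -/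
  fiber : X → Type v
  [addCommGroup : ∀ x, AddCommGroup (fiber x)]
  [module : ∀ x, Module ℂ (fiber x)]
  [topFiber : ∀ x, TopologicalSpace (fiber x)]
  [topTotal : TopologicalSpace (Bundle.TotalSpace (Fin q → ℂ) fiber)]
  [fiberBundle : FiberBundle (Fin q → ℂ) fiber]
  [vectorBundle : VectorBundle ℂ (Fin q → ℂ) fiber]
  /-- the antilinear maps between the fibres -/
  J : ∀ x, fiber x →ₛₗ[starRingEnd ℂ] fiber (j x)
  continuous_J : Continuous fun p : Bundle.TotalSpace (Fin q → ℂ) fiber =>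
    (⟨j p.1, J p.1 p.2⟩ : Bundle.TotalSpace (Fin q → ℂ) fiber)
  J_J : ∀ (x : X) (e : fiber x),
    (⟨j (j x), J (j x) (J x e)⟩ : Bundle.TotalSpace (Fin q → ℂ) fiber) = ⟨x, -e⟩

attribute [instance] QuatBundle.addCommGroup QuatBundle.module QuatBundle.topFiber
  QuatBundle.topTotal QuatBundle.fiberBundle QuatBundle.vectorBundle

variable {j : C(X, X)} {q : ℕ}

/-- The total space of a quaternionic vector bundle. -/
abbrev QuatBundle.Total (E : QuatBundle.{u, v} j q) : Type (max u v) :=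
  Bundle.TotalSpace (Fin q → ℂ) E.fiber

/-- An isomorphism of quaternionic vector bundles over `X`: a fibrewise complex linear
homeomorphism of total spaces over `X` that commutes with the antilinear maps. -/
structure QuatBundle.Iso (E E' : QuatBundle.{u, v} j q) where
  /-- the isomorphisms between the fibres -/
  e : ∀ x, E.fiber x ≃ₗ[ℂ] E'.fiber x
  continuous_toFun : Continuous fun p : E.Total => (⟨p.1, e p.1 p.2⟩ : E'.Total)
  continuous_invFun : Continuous fun p : E'.Total => (⟨p.1, (e p.1).symm p.2⟩ : E.Total)
  comm : ∀ (x : X) (w : E.fiber x), e (j x) (E.J x w) = E'.J x (e x w)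

/-- Isomorphism of quaternionic vector bundles is an equivalence relation. -/
instance QuatBundle.isoSetoid (j : C(X, X)) (q : ℕ) : Setoid (QuatBundle.{u, v} j q) where
  r E E' := Nonempty (QuatBundle.Iso E E')
  iseqv :=
    { refl := fun E => ⟨⟨fun _ => LinearEquiv.refl ℂ _, continuous_id, continuous_id,
        fun _ _ => rfl⟩⟩
      symm := fun {E E'} ⟨φ⟩ => ⟨⟨fun x => (φ.e x).symm, φ.continuous_invFun,
        φ.continuous_toFun, fun x w => by
          rw [LinearEquiv.symm_apply_eq, φ.comm, LinearEquiv.apply_symm_apply]⟩⟩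
      trans := fun {E E' E''} ⟨φ⟩ ⟨ψ⟩ => ⟨⟨fun x => (φ.e x).trans (ψ.e x),
        ψ.continuous_toFun.comp φ.continuous_toFun,
        φ.continuous_invFun.comp ψ.continuous_invFun,
        fun x w => by
          simp only [LinearEquiv.trans_apply, φ.comm, ψ.comm]⟩⟩ }

/-- Isomorphism classes of quaternionic vector bundles of complex rank `q` over `(X, j)`. -/
def QuatBundleClasses (j : C(X, X)) (q : ℕ) : Type (max u (v + 1)) :=
  Quotient (QuatBundle.isoSetoid.{u, v} j q)

/-! ### `ℤ₂`-maps into the Grassmannian and their `ℤ₂`-homotopy classes -/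

/-- A map `f : X → G^q_ℂ(ℙ_ℂ(ℍ^∞))` is a `ℤ₂`-map if it commutes with the involutions. -/
def IsZ2Map (j : C(X, X)) {q : ℕ} (f : C(X, GrInf q)) : Prop :=
  ∀ x, f (j x) = (f x).conj

/-- The `ℤ₂`-maps `X → G^q_ℂ(ℙ_ℂ(ℍ^∞))`. -/
structure Z2Map (j : C(X, X)) (q : ℕ) where
  /-- the underlying continuous map -/
  map : C(X, GrInf q)
  isZ2Map : IsZ2Map j map

/-- `ℤ₂`-homotopy: homotopy through `ℤ₂`-maps. -/
instance Z2Map.homotopySetoid (j : C(X, X)) (q : ℕ) : Setoid (Z2Map j q) where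
  r f g := ContinuousMap.HomotopicWith f.map g.map (IsZ2Map j)
  iseqv :=
    { refl := fun f => ContinuousMap.HomotopicWith.refl f.map f.isZ2Map
      symm := fun h => h.symm
      trans := fun h h' => h.trans h' }

/-- `ℤ₂`-homotopy classes of `ℤ₂`-maps `X → G^q_ℂ(ℙ_ℂ(ℍ^∞))`. -/
def Z2HomotopyClasses (j : C(X, X)) (q : ℕ) : Type u :=
  Quotient (Z2Map.homotopySetoid j q)

/-- The `ℤ₂`-map `f` classifies the quaternionic bundle `E`, that is, `E` is isomorphic to the
pullback along `f` of the universal quotient bundle: there is a continuous map from the total space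
of `E` to the total space of the universal quotient bundle that covers `f`, is a complex linear
isomorphism on each fibre, and commutes with the quaternionic structures. -/
def IsClassifiedBy (E : QuatBundle.{u, v} j q) (f : Z2Map j q) : Prop :=
  ∃ Ψ : ∀ x, E.fiber x ≃ₗ[ℂ] (HInf ⧸ (f.map x).sub),
    Continuous (fun p : E.Total => (⟨f.map p.1, Ψ p.1 p.2⟩ : UnivQuot q)) ∧
    ∀ (x : X) (w : E.fiber x),
      (⟨f.map (j x), Ψ (j x) (E.J x w)⟩ : UnivQuot q) = UnivQuot.conj ⟨f.map x, Ψ x w⟩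

end Bundles

end Quaternionic

end

/-! The proof replaces classifying maps by presentations: `f` classifies `E` exactly when there are
linear surjections `a x : ℍ^∞ → E x` with kernel `f x`, continuous in `x` and commuting with the
quaternionic structures (`isClassifiedBy_iff`). Two bundles presented by the same `f` are both `ℍ^∞
⧸ f x` fibrewise, hence isomorphic (`IsPresentation.iso`), and the pullback of the universal bundle
has the tautological presentation. Conversely, an equivariant continuous family of surjections that
factors through one finite stage `ℍⁿ` has kernels forming a `ℤ₂`-map (`exists_isPresentation`).

Surjectivity (`QuatBundle.exists_classifying`): finitely many sections `s_k` span every fibre;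
sending the `k`-th basis quaternion to `s_k` and `j` times it to the conjugate section gives a
presentation.

Injectivity (`IsClassifiedBy.homotopic`): by compactness, presentations `a`, `b` of the same `E`
factor through some `ℍ^N` (`exists_ker_trunc_le`). After `b` is moved to the coordinates beyond `N`,
the segment from `a` to `b` consists of surjections, and its kernels form a `ℤ₂`-homotopy. The same
argument joins `b` to its own shift.

Homotopy invariance (`IsClassifiedBy.of_homotopic`): a presentation has a continuous equivariant
splitting, obtained by a partition of unity and averaging. Its image is complementary to the
kernels, and by compactness of `X` stays complementary at nearby times of a homotopy. So the times
at which a given bundle is classified form an open set; applied to the pullbacks, this also shows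
that the set is closed, and the unit interval is connected. -/

noncomputable section
set_option linter.unusedSectionVars false
namespace Quaternionic

/-! ### Continuous sections and frames of a vector bundle in local coordinates -/

section Frames

variable {B : Type*} [TopologicalSpace B] {q : ℕ} {E : B → Type*}
  [∀ b, AddCommGroup (E b)] [∀ b, Module ℂ (E b)] [∀ b, TopologicalSpace (E b)]
  [TopologicalSpace (Bundle.TotalSpace (Fin q → ℂ) E)] [FiberBundle (Fin q → ℂ) E]
  [VectorBundle ℂ (Fin q → ℂ) E]

variable (E) in
/-- The coordinates on the fibre over `b` given by the preferred trivialization at `b₀`. -/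
def locCoord (b₀ b : B) : E b →ₗ[ℂ] (Fin q → ℂ) :=
  (trivializationAt (Fin q → ℂ) E b₀).linearMapAt ℂ b

variable (E) in
/-- The points where the preferred trivialization at `b₀` is defined. -/
def locDomain (q : ℕ) [TopologicalSpace (Bundle.TotalSpace (Fin q → ℂ) E)]
    [FiberBundle (Fin q → ℂ) E] (b₀ : B) : Set B :=
  (trivializationAt (Fin q → ℂ) E b₀).baseSet

variable (E) in
theorem isOpen_locDomain (b₀ : B) : IsOpen (locDomain E q b₀) :=
  (trivializationAt (Fin q → ℂ) E b₀).open_baseSet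

variable (E) in
theorem mem_locDomain (b₀ : B) : b₀ ∈ locDomain E q b₀ :=
  FiberBundle.mem_baseSet_trivializationAt' b₀

theorem locCoord_apply {b₀ b : B} (hb : b ∈ locDomain E q b₀) (v : E b) :
    locCoord E b₀ b v = (trivializationAt (Fin q → ℂ) E b₀ ⟨b, v⟩).2 := by
  rw [locCoord, Bundle.Trivialization.coe_linearMapAt_of_mem _ hb]

/-- On its domain, the coordinate map is an isomorphism. -/
def locEquiv {b₀ b : B} (hb : b ∈ locDomain E q b₀) : E b ≃ₗ[ℂ] (Fin q → ℂ) :=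
  (trivializationAt (Fin q → ℂ) E b₀).linearEquivAt ℂ b hb

theorem coe_locEquiv {b₀ b : B} (hb : b ∈ locDomain E q b₀) :
    (locEquiv hb : E b →ₗ[ℂ] (Fin q → ℂ)) = locCoord E b₀ b := by
  ext1 v
  rw [locCoord_apply hb]
  rfl

theorem locEquiv_apply {b₀ b : B} (hb : b ∈ locDomain E q b₀) (v : E b) :
    locEquiv hb v = locCoord E b₀ b v :=
  LinearMap.congr_fun (coe_locEquiv hb) v

variable (E q) in
theorem finrank_fiber (b : B) : Module.finrank ℂ (E b) = q := by
  rw [(locEquiv (mem_locDomain (q := q) E b)).finrank_eq]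
  simp

variable {Y : Type*} [TopologicalSpace Y] {p : Y → B} {y₀ : Y}

/-- The trivialization stays fixed at `p y₀` while `y` varies, so continuity becomes that of a
`ℂ^q`-valued function. That `locCoord` vanishes off its domain is harmless: only the germ at `y₀`
matters. -/
theorem continuousAt_section_iff (s : ∀ y, E (p y)) :
    ContinuousAt (fun y => (⟨p y, s y⟩ : Bundle.TotalSpace (Fin q → ℂ) E)) y₀ ↔
      ContinuousAt p y₀ ∧ ContinuousAt (fun y => locCoord (q := q) E (p y₀) (p y) (s y)) y₀ := by
  rw [FiberBundle.continuousAt_totalSpace]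
  refine and_congr_right fun hp => continuousAt_congr ?_
  filter_upwards [hp ((isOpen_locDomain E (q := q) _).mem_nhds (mem_locDomain E (p y₀)))]
    with y hy
  rw [locCoord_apply hy]

variable {ι : Type*} [Fintype ι]

theorem continuousAt_sum_smul {s : ι → ∀ y, E (p y)} {c : ι → Y → ℂ} (hp : ContinuousAt p y₀)
    (hs : ∀ i, ContinuousAt
      (fun y => (⟨p y, s i y⟩ : Bundle.TotalSpace (Fin q → ℂ) E)) y₀)
    (hc : ∀ i, ContinuousAt (c i) y₀) :
    ContinuousAt
      (fun y => (⟨p y, ∑ i, c i y • s i y⟩ : Bundle.TotalSpace (Fin q → ℂ) E)) y₀ := by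
  refine (continuousAt_section_iff _).2 ⟨hp, ?_⟩
  simp only [map_sum, map_smul]
  exact tendsto_finsetSum _ fun i _ => (hc i).smul ((continuousAt_section_iff _).1 (hs i)).2

theorem continuous_sum_smul {s : ι → ∀ y, E (p y)} {c : ι → Y → ℂ} (hp : Continuous p)
    (hs : ∀ i, Continuous (fun y => (⟨p y, s i y⟩ : Bundle.TotalSpace (Fin q → ℂ) E)))
    (hc : ∀ i, Continuous (c i)) :
    Continuous
      (fun y => (⟨p y, ∑ i, c i y • s i y⟩ : Bundle.TotalSpace (Fin q → ℂ) E)) :=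
  continuous_iff_continuousAt.2 fun _ => continuousAt_sum_smul hp.continuousAt
    (fun i => (hs i).continuousAt) fun i => (hc i).continuousAt

/-- The matrix of a tuple of sections in the coordinates at `b₀`. -/
def sectionMatrix (b₀ : B) (s : Fin q → ∀ y, E (p y)) (y : Y) : Matrix (Fin q) (Fin q) ℂ :=
  fun i => locCoord E b₀ (p y) (s i y)

/-- Independence as a nonvanishing determinant is an open condition, and it supplies the inverse
matrix that computes coordinates in a frame. -/
theorem linearIndependent_iff_det_sectionMatrix {b₀ : B} {s : Fin q → ∀ y, E (p y)} {y : Y}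
    (hy : p y ∈ locDomain E q b₀) :
    LinearIndependent ℂ (fun i => s i y) ↔ (sectionMatrix b₀ s y).det ≠ 0 := by
  rw [← isUnit_iff_ne_zero, ← Matrix.isUnit_iff_isUnit_det,
    ← Matrix.linearIndependent_rows_iff_isUnit,
    ← LinearMap.linearIndependent_iff (locEquiv hy : E (p y) →ₗ[ℂ] (Fin q → ℂ))
      (LinearEquiv.ker _), coe_locEquiv hy]
  rfl

theorem continuousAt_sectionMatrix {s : Fin q → ∀ y, E (p y)}
    (hs : ∀ i, ContinuousAt
      (fun y => (⟨p y, s i y⟩ : Bundle.TotalSpace (Fin q → ℂ) E)) y₀) :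
    ContinuousAt (sectionMatrix (p y₀) s) y₀ :=
  continuousAt_pi.2 fun i => ((continuousAt_section_iff _).1 (hs i)).2

/-- Continuous sections that are independent at a point are independent near that point. -/
theorem eventually_linearIndependent {s : Fin q → ∀ y, E (p y)} (hp : ContinuousAt p y₀)
    (hs : ∀ i, ContinuousAt
      (fun y => (⟨p y, s i y⟩ : Bundle.TotalSpace (Fin q → ℂ) E)) y₀)
    (h₀ : LinearIndependent ℂ (fun i => s i y₀)) :
    ∀ᶠ y in 𝓝 y₀, LinearIndependent ℂ (fun i => s i y) := by
  have hdet : ContinuousAt (fun y => (sectionMatrix (p y₀) s y).det) y₀ :=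
    (Continuous.matrix_det continuous_id).continuousAt.comp (continuousAt_sectionMatrix hs)
  have hne := (linearIndependent_iff_det_sectionMatrix (mem_locDomain E (p y₀))).1 h₀
  filter_upwards [hdet.eventually_ne hne,
    hp ((isOpen_locDomain E (q := q) _).mem_nhds (mem_locDomain E (p y₀)))] with y hy hy'
  exact (linearIndependent_iff_det_sectionMatrix hy').2 hy

/-- The coordinates of a continuous section in a frame of continuous sections are continuous. -/
theorem exists_continuousAt_coords {s : Fin q → ∀ y, E (p y)} {t : ∀ y, E (p y)}
    (hs : ∀ i, ContinuousAt
      (fun y => (⟨p y, s i y⟩ : Bundle.TotalSpace (Fin q → ℂ) E)) y₀)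
    (ht : ContinuousAt (fun y => (⟨p y, t y⟩ : Bundle.TotalSpace (Fin q → ℂ) E)) y₀)
    (h₀ : LinearIndependent ℂ (fun i => s i y₀)) :
    ∃ c : Y → Fin q → ℂ, ContinuousAt c y₀ ∧ ∀ᶠ y in 𝓝 y₀, t y = ∑ i, c y i • s i y := by
  obtain ⟨hp, ht⟩ := (continuousAt_section_iff _).1 ht
  have hM := continuousAt_sectionMatrix hs
  have hdet : ContinuousAt (fun y => (sectionMatrix (p y₀) s y).det) y₀ :=
    (Continuous.matrix_det continuous_id).continuousAt.comp hM
  have hne := (linearIndependent_iff_det_sectionMatrix (mem_locDomain E (p y₀))).1 h₀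
  -- The rows of the matrix are the `s i`, so the coefficients are the row of `t` times the inverse;
  -- continuity follows from inverse = adjugate / determinant.
  refine ⟨fun y => Matrix.vecMul (locCoord E (p y₀) (p y) (t y)) (sectionMatrix (p y₀) s y)⁻¹,
    ?_, ?_⟩
  · have hinv : ContinuousAt (fun y => (sectionMatrix (p y₀) s y)⁻¹) y₀ := by
      simp only [Matrix.inv_def, Ring.inverse_eq_inv']
      exact (hdet.inv₀ hne).smul
        ((Continuous.matrix_adjugate continuous_id).continuousAt.comp hM)
    refine continuousAt_pi.2 fun k => ?_
    simp only [Matrix.vecMul, dotProduct]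
    refine tendsto_finsetSum _ fun i _ => ?_
    exact (continuousAt_pi.1 ht i).mul (continuousAt_pi.1 (continuousAt_pi.1 hinv i) k)
  · filter_upwards [hdet.eventually_ne hne,
      hp ((isOpen_locDomain E (q := q) _).mem_nhds (mem_locDomain E (p y₀)))] with y hy hy'
    apply (locEquiv hy').injective
    rw [map_sum]
    simp only [map_smul, locEquiv_apply]
    set M := sectionMatrix (p y₀) s y with hM_def
    have h := Matrix.vecMul_vecMul (locCoord E (p y₀) (p y) (t y)) M⁻¹ M
    rw [Matrix.nonsing_inv_mul _ (isUnit_iff_ne_zero.2 hy), Matrix.vecMul_one] at h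
    conv_lhs => rw [← h, Matrix.vecMul_eq_sum]
    rfl

end Frames

/-! ### Truncation and inclusion -/

theorem trunc_eq_zero_iff {n : ℕ} {w : HInf} : trunc n w = 0 ↔ ∀ k < n, w k = 0 :=
  ⟨fun h k hk => congrFun h ⟨k, hk⟩, fun h => funext fun k => h k k.2⟩

theorem ker_trunc_antitone {m n : ℕ} (hmn : m ≤ n) :
    LinearMap.ker (trunc n) ≤ LinearMap.ker (trunc m) := fun _ hw =>
  trunc_eq_zero_iff.2 fun k hk => trunc_eq_zero_iff.1 hw k (hk.trans_le hmn)

/-- The inclusion `ℍⁿ → ℍ^∞` as a linear map. -/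
def inclLin (n : ℕ) : (Fin n → H) →ₗ[ℂ] HInf where
  toFun := incl n
  map_add' x y := by simp [incl, Finset.sum_add_distrib]
  map_smul' c x := by simp [incl, Finset.smul_sum]

theorem inclLin_apply {n : ℕ} (w : Fin n → H) : inclLin n w = incl n w := rfl

theorem incl_apply_of_lt {n : ℕ} (w : Fin n → H) {k : ℕ} (hk : k < n) :
    incl n w k = w ⟨k, hk⟩ := by
  rw [incl, Finsupp.finsetSum_apply, Finset.sum_eq_single ⟨k, hk⟩]
  · simp
  · intro i _ hi
    exact Finsupp.single_eq_of_ne fun h => hi (Fin.ext h.symm)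
  · simp

theorem incl_apply_of_le {n : ℕ} (w : Fin n → H) {k : ℕ} (hk : n ≤ k) : incl n w k = 0 := by
  rw [incl, Finsupp.finsetSum_apply]
  exact Finset.sum_eq_zero fun i _ => Finsupp.single_eq_of_ne fun h => by have := i.2; omega

theorem trunc_incl {n : ℕ} (w : Fin n → H) : trunc n (incl n w) = w :=
  funext fun k => incl_apply_of_lt w k.2

theorem trunc_surjective (n : ℕ) : Function.Surjective (trunc n) :=
  fun w => ⟨incl n w, trunc_incl w⟩

theorem incl_jFin {n : ℕ} (w : Fin n → H) : incl n (jFin n w) = jInf (incl n w) := by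
  ext1 k
  rcases lt_or_ge k n with hk | hk
  · rw [incl_apply_of_lt _ hk]
    change jH _ = jH _
    rw [incl_apply_of_lt _ hk]
  · rw [incl_apply_of_le _ hk]
    change 0 = jH _
    rw [incl_apply_of_le _ hk, map_zero]

theorem trunc_sub_incl_trunc {n : ℕ} (w : HInf) : trunc n (w - incl n (trunc n w)) = 0 := by
  rw [map_sub, trunc_incl, sub_self]

theorem incl_trunc_of_support {n : ℕ} {w : HInf} (hw : ∀ k, n ≤ k → w k = 0) :
    incl n (trunc n w) = w := by
  ext1 k
  rcases lt_or_ge k n with hk | hk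
  · rw [incl_apply_of_lt _ hk]; rfl
  · rw [incl_apply_of_le _ hk, hw k hk]

theorem exists_support_bound (w : HInf) : ∃ n, ∀ k, n ≤ k → w k = 0 := by
  refine ⟨w.support.sup id + 1, fun k hk => ?_⟩
  by_contra h
  have := Finset.le_sup (f := id) (Finsupp.mem_support_iff.2 h)
  simp only [id] at this
  omega

theorem exists_incl_eq {ι : Type*} [Finite ι] (c : ι → HInf) :
    ∃ (n : ℕ) (c' : ι → Fin n → H), ∀ i, incl n (c' i) = c i := by
  have := Fintype.ofFinite ι
  choose N hN using fun i => exists_support_bound (c i)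
  refine ⟨Finset.univ.sup N, fun i => trunc _ (c i), fun i => incl_trunc_of_support fun k hk => ?_⟩
  exact hN i k ((Finset.le_sup (Finset.mem_univ i)).trans hk)

/-! ### Points and open sets of the Grassmannian -/

variable {q : ℕ}

/-- The linear surjections `ℍⁿ → ℂ^q`. -/
abbrev Epis (q n : ℕ) : Type :=
  {A : (Fin n → H) →L[ℂ] (Fin q → ℂ) // Function.Surjective A}

/-- The kernel of a linear surjection `ℍⁿ → ℂ^q`, as a point of the infinite Grassmannian. -/
def stagePoint {n : ℕ} (A : Epis q n) : GrInf q := GrInf.ofStage n (Gr.ker A)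

theorem mem_stagePoint {n : ℕ} {A : Epis q n} {w : HInf} :
    w ∈ (stagePoint A).sub ↔ A.1 (trunc n w) = 0 := Iff.rfl

theorem continuous_stagePoint (n : ℕ) : Continuous (stagePoint (q := q) (n := n)) := by
  refine continuous_iff_coinduced_le.2 ?_
  have h : TopologicalSpace.coinduced (stagePoint (q := q) (n := n)) inferInstance =
      TopologicalSpace.coinduced (GrInf.ofStage n) (inferInstance : TopologicalSpace (Gr q n)) :=
    coinduced_compose.symm
  rw [h]
  exact le_iSup (fun n => TopologicalSpace.coinduced (GrInf.ofStage n)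
    (inferInstance : TopologicalSpace (Gr q n))) n

/-- The limit topology and that of each stage are coinduced, so openness can be tested on
surjections, where matrices are available. -/
theorem isOpen_grInf_iff {S : Set (GrInf q)} :
    IsOpen S ↔ ∀ n, IsOpen {A : Epis q n | stagePoint A ∈ S} :=
  isOpen_iSup_iff.trans (forall_congr' fun _ => isOpen_coinduced.trans isOpen_coinduced)

theorem isClosed_grInf_iff {S : Set (GrInf q)} :
    IsClosed S ↔ ∀ n, IsClosed {A : Epis q n | stagePoint A ∈ S} := by
  simp only [← isOpen_compl_iff]
  exact isOpen_grInf_iff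

theorem continuousOn_grInf {Z : Type*} [TopologicalSpace Z] {g : GrInf q → Z} {U : Set (GrInf q)}
    (hU : IsOpen U)
    (h : ∀ n, ContinuousOn (fun A : Epis q n => g (stagePoint A)) {A | stagePoint A ∈ U}) :
    ContinuousOn g U := by
  refine (continuousOn_open_iff hU).2 fun V hV => isOpen_grInf_iff.2 fun n => ?_
  exact (continuousOn_open_iff (isOpen_grInf_iff.1 hU n)).1 (h n) V hV

theorem exists_eq_stagePoint (W : GrInf q) : ∃ (n : ℕ) (A : Epis q n), W = stagePoint A := by
  obtain ⟨n, V, hV⟩ := W.exists_stage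
  have e : ((Fin n → H) ⧸ V.sub) ≃ₗ[ℂ] (Fin q → ℂ) :=
    LinearEquiv.ofFinrankEq _ _ (by rw [V.codim]; simp)
  let A : (Fin n → H) →L[ℂ] (Fin q → ℂ) :=
    LinearMap.toContinuousLinearMap (e.toLinearMap ∘ₗ V.sub.mkQ)
  have hA : Function.Surjective A := e.surjective.comp V.sub.mkQ_surjective
  refine ⟨n, ⟨A, hA⟩, GrInf.ext ?_⟩
  rw [hV]
  ext w
  rw [mem_stagePoint, Submodule.mem_comap]
  change _ ↔ e (V.sub.mkQ (trunc n w)) = 0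
  rw [LinearEquiv.map_eq_zero_iff, Submodule.mkQ_apply, Submodule.Quotient.mk_eq_zero]

/-- The fibre of the universal quotient bundle over the kernel of `A` is `ℂ^q`. -/
def stageEquiv {n : ℕ} (A : Epis q n) : (HInf ⧸ (stagePoint A).sub) ≃ₗ[ℂ] (Fin q → ℂ) :=
  LinearMap.quotKerEquivOfSurjective ((A.1 : (Fin n → H) →ₗ[ℂ] (Fin q → ℂ)) ∘ₗ trunc n)
    (A.2.comp (trunc_surjective n))

theorem stageEquiv_mk {n : ℕ} (A : Epis q n) (w : HInf) :
    stageEquiv A (Submodule.Quotient.mk w) = A.1 (trunc n w) := rfl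

theorem finrank_quotient (W : GrInf q) : Module.finrank ℂ (HInf ⧸ W.sub) = q := by
  obtain ⟨n, A, rfl⟩ := exists_eq_stagePoint W
  rw [(stageEquiv A).finrank_eq]
  simp

instance finiteDimensional_quotient (W : GrInf q) : FiniteDimensional ℂ (HInf ⧸ W.sub) := by
  obtain ⟨n, A, rfl⟩ := exists_eq_stagePoint W
  exact (stageEquiv A).symm.finiteDimensional

/-- The surjection `ℍ^∞ ⧸ W → ℍ^∞ ⧸ W'` between spaces of the same finite dimension is injective. -/
theorem GrInf.eq_of_le {W W' : GrInf q} (h : W.sub ≤ W'.sub) : W = W' := by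
  refine GrInf.ext (le_antisymm h fun w hw => ?_)
  have hs : Function.Surjective (Submodule.factor h) := Submodule.factor_surjective h
  have hi := (LinearMap.injective_iff_surjective_of_finrank_eq_finrank
    ((finrank_quotient W).trans (finrank_quotient W').symm)).2 hs
  have h0 : Submodule.factor h (Submodule.Quotient.mk w) = 0 :=
    (Submodule.Quotient.mk_eq_zero _).2 hw
  exact (Submodule.Quotient.mk_eq_zero _).1 (hi (h0.trans (map_zero _).symm))

/-! ### Compact sets lie in a finite stage -/

theorem continuous_epi_apply {n : ℕ} (w : HInf) :
    Continuous fun A : Epis q n => A.1 (trunc n w) :=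
  (continuous_eval_const (F := (Fin n → H) →L[ℂ] (Fin q → ℂ)) _).comp continuous_subtype_val

theorem isClosed_setOf_mem (w : HInf) : IsClosed {W : GrInf q | w ∈ W.sub} := by
  refine isClosed_grInf_iff.2 fun n => ?_
  exact isClosed_eq (continuous_epi_apply w) continuous_const

/-- Since inclusion forces equality, the closed conditions `w ∈ W'` for `w ∈ W` cut out `W` alone.
-/
theorem isClosed_singleton_grInf (W : GrInf q) : IsClosed ({W} : Set (GrInf q)) := by
  have h : ({W} : Set (GrInf q)) = ⋂ w : W.sub, {W' | (w : HInf) ∈ W'.sub} := by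
    ext W'
    simp only [Set.mem_singleton_iff, Set.mem_iInter, Set.mem_ofPred_eq]
    exact ⟨fun h w => h ▸ w.2, fun h => (GrInf.eq_of_le fun w hw => h ⟨w, hw⟩).symm⟩
  rw [h]
  exact isClosed_iInter fun w => isClosed_setOf_mem _

/-- A compact family of points of the infinite Grassmannian lies in a finite stage. -/
theorem exists_ker_trunc_le {Y : Type*} [TopologicalSpace Y] [CompactSpace Y] (f : C(Y, GrInf q)) :
    ∃ N, ∀ y, LinearMap.ker (trunc N) ≤ (f y).sub := by
  by_contra! hcon
  choose y hy using hcon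
  have hstage : ∀ {n : ℕ} (A : Epis q n), LinearMap.ker (trunc n) ≤ (stagePoint A).sub := by
    intro n A w hw
    rw [LinearMap.mem_ker] at hw
    rw [mem_stagePoint, hw, map_zero]
  -- The value `f (y k)` lies in no stage `n ≤ k`, so each stage meets a tail of the sequence in
  -- finitely many points and the tails are closed. By compactness some `f z` lies in all of them;
  -- but `f z` lies in a stage `n` and equals some `f (y k)` with `k ≥ n`.
  let S : ℕ → Set (GrInf q) := fun m => (fun k => f (y k)) '' Set.Ici m
  have hS : ∀ m, IsClosed (S m) := by
    intro m
    refine isClosed_grInf_iff.2 fun n => ?_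
    have hfin : IsClosed ((fun k => f (y k)) '' Set.Ico m n) := by
      have hf : ((fun k => f (y k)) '' Set.Ico m n).Finite := (Set.finite_Ico m n).image _
      rw [← Set.biUnion_of_singleton ((fun k => f (y k)) '' Set.Ico m n)]
      exact hf.isClosed_biUnion fun W _ => isClosed_singleton_grInf W
    convert hfin.preimage (continuous_stagePoint n) using 1
    ext A
    constructor
    · rintro ⟨k, hk, hkA⟩
      refine ⟨k, ⟨hk, ?_⟩, hkA⟩
      by_contra! hnk
      refine hy k ((ker_trunc_antitone hnk).trans ?_)
      have hkA' : f (y k) = stagePoint A := hkA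
      rw [hkA']
      exact hstage A
    · rintro ⟨k, hk, hkA⟩
      exact ⟨k, hk.1, hkA⟩
  obtain ⟨z, hz⟩ := IsCompact.nonempty_iInter_of_sequence_nonempty_isCompact_isClosed
    (fun m => f ⁻¹' S m)
    (fun m => Set.preimage_mono (Set.image_mono (Set.Ici_subset_Ici.2 m.le_succ)))
    (fun m => ⟨y m, m, Set.mem_Ici.2 le_rfl, rfl⟩)
    ((hS 0).preimage f.continuous).isCompact (fun m => (hS m).preimage f.continuous)
  obtain ⟨n, A, hA⟩ := exists_eq_stagePoint (f z)
  obtain ⟨k, hk, hkz⟩ := Set.mem_iInter.1 hz n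
  have hkA : f (y k) = stagePoint A := hkz.trans hA
  exact hy k ((ker_trunc_antitone hk).trans (hkA ▸ hstage A))

/-! ### Charts of the Grassmannian -/

/-- The points of the Grassmannian over which a given tuple of vectors is a frame of the universal
quotient bundle. -/
def frameSet (c : Fin q → HInf) : Set (GrInf q) :=
  {W | LinearIndependent ℂ fun i => (Submodule.Quotient.mk (c i) : HInf ⧸ W.sub)}

theorem exists_mem_frameSet (W : GrInf q) : ∃ c : Fin q → HInf, W ∈ frameSet c := by
  let b := Module.finBasisOfFinrankEq ℂ (HInf ⧸ W.sub) (finrank_quotient W)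
  choose c hc using fun i => Submodule.Quotient.mk_surjective W.sub (b i)
  refine ⟨c, ?_⟩
  rw [frameSet, Set.mem_ofPred_eq]
  simp only [hc]
  exact b.linearIndependent

/-- The coordinates in the frame given by a tuple of vectors. -/
def frameEquiv {c : Fin q → HInf} {W : GrInf q} (hW : W ∈ frameSet c) :
    (HInf ⧸ W.sub) ≃ₗ[ℂ] (Fin q → ℂ) :=
  (basisOfLinearIndependentOfCardEqFinrank' (b := fun i =>
    (Submodule.Quotient.mk (c i) : HInf ⧸ W.sub)) hW
      (by rw [finrank_quotient, Fintype.card_fin])).equivFun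

theorem frameEquiv_symm_apply {c : Fin q → HInf} {W : GrInf q} (hW : W ∈ frameSet c)
    (x : Fin q → ℂ) :
    (frameEquiv hW).symm x = ∑ i, x i • (Submodule.Quotient.mk (c i) : HInf ⧸ W.sub) := by
  rw [frameEquiv, Module.Basis.equivFun_symm_apply]
  exact Finset.sum_congr rfl fun i _ =>
    congrArg (x i • ·) (congrFun (coe_basisOfLinearIndependentOfCardEqFinrank' _ hW _) i)

open Classical in
/-- The coordinates in the frame given by a tuple of vectors, extended by zero to the points where
the tuple is not a frame. -/
def frameLin (c : Fin q → HInf) (W : GrInf q) : (HInf ⧸ W.sub) →ₗ[ℂ] (Fin q → ℂ) :=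
  if hW : W ∈ frameSet c then (frameEquiv hW).toLinearMap else 0

theorem frameLin_of_mem {c : Fin q → HInf} {W : GrInf q} (hW : W ∈ frameSet c)
    (v : HInf ⧸ W.sub) : frameLin c W v = frameEquiv hW v := by
  rw [frameLin, dif_pos hW]
  rfl

/-- The coordinates of a vector in the frame given by a tuple of vectors. -/
def frameCoord (c : Fin q → HInf) (w : HInf) (W : GrInf q) : Fin q → ℂ :=
  frameLin c W (Submodule.Quotient.mk w)

theorem frameCoord_of_mem {c : Fin q → HInf} {W : GrInf q} (hW : W ∈ frameSet c) (w : HInf) :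
    frameCoord c w W = frameEquiv hW (Submodule.Quotient.mk w) := frameLin_of_mem hW _

/-- The matrix of a tuple of vectors in the coordinates given by a surjection. -/
def epiMatrix (c : Fin q → HInf) {n : ℕ} (A : Epis q n) : Matrix (Fin q) (Fin q) ℂ :=
  fun i => A.1 (trunc n (c i))

theorem continuous_epiMatrix (c : Fin q → HInf) (n : ℕ) :
    Continuous (epiMatrix c : Epis q n → _) :=
  continuous_pi fun i => continuous_epi_apply (c i)

theorem stagePoint_mem_frameSet_iff {c : Fin q → HInf} {n : ℕ} {A : Epis q n} :
    stagePoint A ∈ frameSet c ↔ (epiMatrix c A).det ≠ 0 := by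
  rw [← isUnit_iff_ne_zero, ← Matrix.isUnit_iff_isUnit_det,
    ← Matrix.linearIndependent_rows_iff_isUnit, frameSet, Set.mem_ofPred_eq,
    ← LinearMap.linearIndependent_iff (stageEquiv A).toLinearMap (LinearEquiv.ker _)]
  rfl

theorem isOpen_frameSet (c : Fin q → HInf) : IsOpen (frameSet c) := by
  refine isOpen_grInf_iff.2 fun n => ?_
  simp only [stagePoint_mem_frameSet_iff]
  exact isOpen_ne_fun (continuous_epiMatrix c n).matrix_det continuous_const

/-- `stageEquiv A` turns the frame into the rows of `epiMatrix c A`, so finding coordinates is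
solving a linear system. The resulting formula is visibly continuous in `A`. -/
theorem frameCoord_stagePoint {c : Fin q → HInf} {n : ℕ} {A : Epis q n}
    (hA : stagePoint A ∈ frameSet c) (w : HInf) :
    frameCoord c w (stagePoint A) = Matrix.vecMul (A.1 (trunc n w)) (epiMatrix c A)⁻¹ := by
  rw [frameCoord_of_mem hA]
  apply (frameEquiv hA).symm.injective
  apply (stageEquiv A).injective
  rw [LinearEquiv.symm_apply_apply, frameEquiv_symm_apply, map_sum]
  simp only [map_smul, stageEquiv_mk]
  have h := Matrix.vecMul_vecMul (A.1 (trunc n w)) (epiMatrix c A)⁻¹ (epiMatrix c A)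
  rw [Matrix.nonsing_inv_mul _ (isUnit_iff_ne_zero.2 (stagePoint_mem_frameSet_iff.1 hA)),
    Matrix.vecMul_one] at h
  conv_lhs => rw [← h, Matrix.vecMul_eq_sum]
  rfl

theorem continuousOn_frameCoord (c : Fin q → HInf) (w : HInf) :
    ContinuousOn (frameCoord c w) (frameSet c) := by
  refine continuousOn_grInf (isOpen_frameSet c) fun n => ?_
  refine ContinuousOn.congr (f := fun A : Epis q n =>
    Matrix.vecMul (A.1 (trunc n w)) (epiMatrix c A)⁻¹) ?_ fun A hA => frameCoord_stagePoint hA w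
  have hinv : ContinuousOn (fun A : Epis q n => (epiMatrix c A)⁻¹)
      {A | stagePoint A ∈ frameSet c} := by
    simp only [Matrix.inv_def, Ring.inverse_eq_inv']
    exact ((continuous_epiMatrix c n).matrix_det.continuousOn.inv₀ fun A hA =>
      stagePoint_mem_frameSet_iff.1 hA).smul (continuous_epiMatrix c n).matrix_adjugate.continuousOn
  refine continuousOn_pi.2 fun k => ?_
  simp only [Matrix.vecMul, dotProduct]
  refine continuousOn_finsetSum _ fun i _ => ?_
  exact ((continuous_apply i).comp (continuous_epi_apply w)).continuousOn.mul
    (continuousOn_pi.1 (continuousOn_pi.1 hinv i) k)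

/-! ### The pullback of the universal quotient bundle -/

section Pullback

variable {X : Type u} [TopologicalSpace X] {q : ℕ}

/-- The fibres of the pullback of the universal quotient bundle. -/
def PullFiber (f : C(X, GrInf q)) (x : X) : Type v := ULift.{v} (HInf ⧸ (f x).sub)

instance (f : C(X, GrInf q)) (x : X) : AddCommGroup (PullFiber.{u, v} f x) :=
  inferInstanceAs (AddCommGroup (ULift _))

instance (f : C(X, GrInf q)) (x : X) : Module ℂ (PullFiber.{u, v} f x) :=
  inferInstanceAs (Module ℂ (ULift _))

/-- The fibre of the pullback is the fibre of the universal quotient bundle. -/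
def pullEquiv (f : C(X, GrInf q)) (x : X) : PullFiber.{u, v} f x ≃ₗ[ℂ] (HInf ⧸ (f x).sub) :=
  ULift.moduleEquiv

/-- The projection of `ℍ^∞` onto the fibre of the pullback. -/
def pullMk (f : C(X, GrInf q)) (x : X) : HInf →ₗ[ℂ] PullFiber.{u, v} f x :=
  (pullEquiv f x).symm.toLinearMap ∘ₗ (f x).sub.mkQ

theorem pullEquiv_pullMk (f : C(X, GrInf q)) (x : X) (w : HInf) :
    pullEquiv f x (pullMk.{u, v} f x w) = Submodule.Quotient.mk w := rfl

theorem pullMk_surjective (f : C(X, GrInf q)) (x : X) :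
    Function.Surjective (pullMk.{u, v} f x) :=
  (pullEquiv f x).symm.surjective.comp (f x).sub.mkQ_surjective

theorem pullMk_eq_zero_iff (f : C(X, GrInf q)) (x : X) {w : HInf} :
    pullMk.{u, v} f x w = 0 ↔ w ∈ (f x).sub := by
  rw [← LinearEquiv.map_eq_zero_iff (pullEquiv f x), pullEquiv_pullMk,
    Submodule.Quotient.mk_eq_zero]

/-- The trivialization of the pullback given by a tuple of vectors. -/
def pullPretriv (f : C(X, GrInf q)) (c : Fin q → HInf) :
    Bundle.Pretrivialization (Fin q → ℂ)
      (Bundle.TotalSpace.proj (F := Fin q → ℂ) (E := PullFiber.{u, v} f)) where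
  toFun p := (p.1, frameLin c (f p.1) (pullEquiv f p.1 p.2))
  invFun p := ⟨p.1, ∑ i, p.2 i • pullMk f p.1 (c i)⟩
  source := {p | f p.1 ∈ frameSet c}
  target := {p | f p.1 ∈ frameSet c}
  map_source' _ hp := hp
  map_target' _ hp := hp
  left_inv' := by
    rintro ⟨x, v⟩ hp
    refine congrArg (Bundle.TotalSpace.mk x) ((pullEquiv f x).injective ?_)
    simp only [map_sum, map_smul, pullEquiv_pullMk]
    rw [frameLin_of_mem hp, ← frameEquiv_symm_apply hp, LinearEquiv.symm_apply_apply]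
  right_inv' := by
    rintro ⟨x, y⟩ hp
    refine Prod.ext rfl ?_
    simp only [map_sum, map_smul, pullEquiv_pullMk]
    simp only [← map_smul, ← map_sum]
    rw [← frameEquiv_symm_apply hp, frameLin_of_mem hp, LinearEquiv.apply_symm_apply]
  open_target := ((isOpen_frameSet c).preimage f.continuous).preimage continuous_fst
  baseSet := f ⁻¹' frameSet c
  open_baseSet := (isOpen_frameSet c).preimage f.continuous
  source_eq := rfl
  target_eq := by ext; simp
  proj_toFun _ _ := rfl

/-- A frame of the universal quotient bundle at a given point. -/
def pullFrame (f : C(X, GrInf q)) (x : X) : Fin q → HInf := (exists_mem_frameSet (f x)).choose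

theorem mem_pullFrame (f : C(X, GrInf q)) (x : X) : f x ∈ frameSet (pullFrame f x) :=
  (exists_mem_frameSet (f x)).choose_spec

/-- Inducing the topology from the preferred chart makes `totalSpaceMk_isInducing` below hold by
definition. -/
instance (f : C(X, GrInf q)) (x : X) : TopologicalSpace (PullFiber.{u, v} f x) :=
  TopologicalSpace.induced (pullPretriv f (pullFrame f x) ∘ Bundle.TotalSpace.mk x) inferInstance

/-- The pullback of the universal quotient bundle, as a vector prebundle. -/
def pullPrebundle (f : C(X, GrInf q)) : VectorPrebundle ℂ (Fin q → ℂ) (PullFiber.{u, v} f) where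
  pretrivializationAtlas := Set.range (pullPretriv f)
  pretrivialization_linear' := by
    rintro _ ⟨c, rfl⟩
    exact ⟨fun x _ => (frameLin c (f x) ∘ₗ (pullEquiv f x).toLinearMap).isLinear⟩
  pretrivializationAt x := pullPretriv f (pullFrame f x)
  mem_base_pretrivializationAt x := mem_pullFrame f x
  pretrivialization_mem_atlas x := ⟨_, rfl⟩
  exists_coordChange := by
    rintro _ ⟨c, rfl⟩ _ ⟨c', rfl⟩
    -- The transition map sends the `i`-th basis vector to the coordinates of `c i` in the frame
    -- `c'`.
    refine ⟨fun x => ∑ i, (ContinuousLinearMap.proj (R := ℂ) (φ := fun _ : Fin q => ℂ) i).smulRight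
      (frameCoord c' (c i) (f x)), ?_, ?_⟩
    · refine continuousOn_clm_apply.2 fun y => ?_
      simp only [sum_apply, ContinuousLinearMap.smulRight_apply]
      refine continuousOn_finsetSum _ fun i _ => ?_
      have h : ContinuousOn (fun x => frameCoord c' (c i) (f x))
          (f ⁻¹' frameSet c ∩ f ⁻¹' frameSet c') :=
        ContinuousOn.comp (t := frameSet c') (continuousOn_frameCoord c' (c i))
          f.continuous.continuousOn fun x hx => hx.2
      exact h.const_smul (y i)
    · rintro x ⟨hx, hx'⟩ y
      rw [Bundle.Pretrivialization.mk_symm _ hx]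
      change _ = frameLin c' (f x) (pullEquiv f x (∑ i, y i • pullMk f x (c i)))
      simp only [map_sum, map_smul, pullEquiv_pullMk]
      simp [frameCoord]
  totalSpaceMk_isInducing x := ⟨rfl⟩

instance (f : C(X, GrInf q)) :
    TopologicalSpace (Bundle.TotalSpace (Fin q → ℂ) (PullFiber.{u, v} f)) :=
  (pullPrebundle f).totalSpaceTopology

instance (f : C(X, GrInf q)) : FiberBundle (Fin q → ℂ) (PullFiber.{u, v} f) :=
  (pullPrebundle f).toFiberBundle

instance (f : C(X, GrInf q)) : VectorBundle ℂ (Fin q → ℂ) (PullFiber.{u, v} f) :=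
  (pullPrebundle f).toVectorBundle

theorem continuous_pullMk (f : C(X, GrInf q)) (w : HInf) :
    Continuous fun x =>
      (⟨x, pullMk f x w⟩ : Bundle.TotalSpace (Fin q → ℂ) (PullFiber.{u, v} f)) := by
  refine continuous_iff_continuousAt.2 fun x₀ => ?_
  refine (continuousAt_section_iff (p := fun x => x) (fun x => pullMk.{u, v} f x w)).2
    ⟨continuousAt_id, ?_⟩
  have h : ContinuousAt (fun x => frameCoord (pullFrame f x₀) w (f x)) x₀ :=
    ((continuousOn_frameCoord _ w).continuousAt
      ((isOpen_frameSet _).mem_nhds (mem_pullFrame f x₀))).comp f.continuous.continuousAt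
  refine h.congr ?_
  filter_upwards [(isOpen_locDomain (q := q) (PullFiber.{u, v} f) x₀).mem_nhds
    (mem_locDomain _ x₀)] with x hx
  rw [locCoord_apply hx]
  rfl

end Pullback

/-! ### Linear families of sections -/

section Family

variable {B : Type*} [TopologicalSpace B] {q : ℕ} {E : B → Type*}
  [∀ b, AddCommGroup (E b)] [∀ b, Module ℂ (E b)] [∀ b, TopologicalSpace (E b)]
  [TopologicalSpace (Bundle.TotalSpace (Fin q → ℂ) E)] [FiberBundle (Fin q → ℂ) E]
  [VectorBundle ℂ (Fin q → ℂ) E] {Y : Type*} [TopologicalSpace Y] {p : Y → B}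

/-- The standard complex basis of `ℍⁿ`, as vectors of `ℍ^∞`. -/
def stdVec {n : ℕ} (i : Fin n ⊕ Fin n) : HInf :=
  i.elim (fun k : Fin n => Finsupp.single (k : ℕ) (1, 0))
    fun k : Fin n => Finsupp.single (k : ℕ) (0, 1)

/-- The complex coordinates of a vector of `ℍⁿ`. -/
def stdCoord {n : ℕ} (w : Fin n → H) (i : Fin n ⊕ Fin n) : ℂ :=
  i.elim (fun k => (w k).1) fun k => (w k).2

theorem incl_eq_sum {n : ℕ} (w : Fin n → H) : incl n w = ∑ i, stdCoord w i • stdVec i := by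
  rw [Fintype.sum_sum_type, ← Finset.sum_add_distrib, incl]
  refine Finset.sum_congr rfl fun k _ => ?_
  simp [stdVec, stdCoord, ← Finsupp.single_add]

theorem continuous_stdCoord {n : ℕ} (i : Fin n ⊕ Fin n) :
    Continuous fun w : Fin n → H => stdCoord w i := by
  rcases i with k | k
  · exact continuous_fst.comp (continuous_apply k)
  · exact continuous_snd.comp (continuous_apply k)

theorem continuousAt_family_incl {a : ∀ y, HInf →ₗ[ℂ] E (p y)} {y₀ : Y}
    (ha : ∀ w, ContinuousAt (fun y => (⟨p y, a y w⟩ : Bundle.TotalSpace (Fin q → ℂ) E)) y₀)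
    {n : ℕ} {u : Y → Fin n → H} (hu : ContinuousAt u y₀) :
    ContinuousAt
      (fun y => (⟨p y, a y (incl n (u y))⟩ : Bundle.TotalSpace (Fin q → ℂ) E)) y₀ := by
  simp only [incl_eq_sum, map_sum, map_smul]
  exact continuousAt_sum_smul ((continuousAt_section_iff _).1 (ha 0)).1 (fun i => ha (stdVec i))
    fun i => (continuous_stdCoord i).continuousAt.comp hu

theorem continuous_family_incl {a : ∀ y, HInf →ₗ[ℂ] E (p y)}
    (ha : ∀ w, Continuous (fun y => (⟨p y, a y w⟩ : Bundle.TotalSpace (Fin q → ℂ) E)))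
    {n : ℕ} {u : Y → Fin n → H} (hu : Continuous u) :
    Continuous (fun y => (⟨p y, a y (incl n (u y))⟩ : Bundle.TotalSpace (Fin q → ℂ) E)) :=
  continuous_iff_continuousAt.2 fun _ =>
    continuousAt_family_incl (fun w => (ha w).continuousAt) hu.continuousAt

theorem exists_frame {b : B} {a : HInf →ₗ[ℂ] E b} (ha : Function.Surjective a) :
    ∃ w : Fin q → HInf, LinearIndependent ℂ fun i => a (w i) := by
  have : FiniteDimensional ℂ (E b) :=
    (locEquiv (mem_locDomain (q := q) E b)).symm.finiteDimensional
  let β := Module.finBasisOfFinrankEq ℂ (E b) (finrank_fiber q E b)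
  choose w hw using fun i => ha (β i)
  refine ⟨w, ?_⟩
  simp only [hw]
  exact β.linearIndependent

/-- If a linear family of continuous sections indexed by `ℍ^∞` spans every fibre, then every
continuous map to the total space is locally a continuous linear combination of finitely many of
these sections. -/
theorem exists_local_lift {Z : Type*} [TopologicalSpace Z] {a : ∀ b, HInf →ₗ[ℂ] E b}
    (ha : ∀ w, Continuous (fun b => (⟨b, a b w⟩ : Bundle.TotalSpace (Fin q → ℂ) E)))
    (hs : ∀ b, Function.Surjective (a b)) {t : Z → Bundle.TotalSpace (Fin q → ℂ) E} {z₀ : Z}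
    (ht : ContinuousAt t z₀) :
    ∃ (w : Fin q → HInf) (c : Z → Fin q → ℂ), ContinuousAt c z₀ ∧
      ∀ᶠ z in 𝓝 z₀, (t z).2 = a (t z).1 (∑ i, c z i • w i) := by
  obtain ⟨w, hw⟩ := exists_frame (q := q) (hs (t z₀).1)
  have hp : ContinuousAt (fun z => (t z).1) z₀ :=
    (FiberBundle.continuous_proj (Fin q → ℂ) E).continuousAt.comp ht
  obtain ⟨c, hc, hce⟩ := exists_continuousAt_coords (E := E) (p := fun z => (t z).1)
    (s := fun i z => a (t z).1 (w i)) (t := fun z => (t z).2)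
    (fun i => ContinuousAt.comp (f := fun z => (t z).1) (ha (w i)).continuousAt hp) ht hw
  refine ⟨w, c, hc, hce.mono fun z hz => ?_⟩
  rw [hz]
  simp

end Family

/-! ### The total space of the universal quotient bundle -/

section UnivQuot

variable {q : ℕ}

theorem UnivQuot.mk_eq_of_eq {W W' : GrInf q} (h : W = W') (w : HInf) :
    (⟨W, Submodule.Quotient.mk w⟩ : UnivQuot q) = ⟨W', Submodule.Quotient.mk w⟩ := by
  subst h; rfl

theorem UnivQuot.conj_mk (W : GrInf q) (w : HInf) :
    UnivQuot.conj ⟨W, Submodule.Quotient.mk w⟩ = ⟨W.conj, Submodule.Quotient.mk (jInf w)⟩ := rfl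

theorem continuous_univQuot_mk (n : ℕ) : Continuous fun p : GrInf q × (Fin n → H) =>
    (⟨p.1, Submodule.Quotient.mk (incl n p.2)⟩ : UnivQuot q) :=
  continuous_iff_coinduced_le.2 (le_iSup (fun n : ℕ => TopologicalSpace.coinduced
    (fun p : GrInf q × (Fin n → H) =>
      (⟨p.1, Submodule.Quotient.mk (incl n p.2)⟩ : UnivQuot q)) inferInstance) n)

/-- The comparison map from the universal quotient bundle to its pullback along the identity. -/
def UnivQuot.toPull (p : UnivQuot q) :
    Bundle.TotalSpace (Fin q → ℂ) (PullFiber.{0, 0} (ContinuousMap.id (GrInf q))) :=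
  ⟨p.base, (pullEquiv (ContinuousMap.id (GrInf q)) p.base).symm p.vec⟩

/-- This turns continuity into `UnivQuot`, known only through its quotient topology, into continuity
in a genuine vector bundle, where coordinates in frames are available. -/
theorem UnivQuot.continuous_toPull : Continuous (UnivQuot.toPull (q := q)) := by
  refine continuous_iSup_dom.2 fun n => continuous_coinduced_dom.2 ?_
  exact continuous_family_incl (p := fun p : GrInf q × (Fin n → H) => p.1)
    (a := fun p => pullMk (ContinuousMap.id (GrInf q)) p.1)
    (fun w => (continuous_pullMk (ContinuousMap.id (GrInf q)) w).comp continuous_fst)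
    continuous_snd

/-- A continuous linear combination of fixed vectors defines a continuous map to the universal
quotient bundle. -/
theorem continuousAt_univQuot_sum {Z ι : Type*} [TopologicalSpace Z] [Fintype ι]
    {W : Z → GrInf q} {c : Z → ι → ℂ} {z₀ : Z} {n : ℕ} {w : ι → Z → Fin n → H}
    (hW : ContinuousAt W z₀) (hc : ContinuousAt c z₀) (hw : ∀ i, ContinuousAt (w i) z₀) :
    ContinuousAt (fun z => (⟨W z, Submodule.Quotient.mk (∑ i, c z i • incl n (w i z))⟩ :
      UnivQuot q)) z₀ := by
  have hu : ContinuousAt (fun z => ∑ i, c z i • w i z) z₀ :=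
    tendsto_finsetSum _ fun i _ => (continuousAt_pi.1 hc i).smul (hw i)
  have h := ContinuousAt.comp (f := fun z => (W z, ∑ i, c z i • w i z))
    (continuous_univQuot_mk (q := q) n).continuousAt (hW.prodMk hu)
  refine h.congr (Filter.Eventually.of_forall fun z => ?_)
  simp only [Function.comp, ← inclLin_apply, map_sum, map_smul]

end UnivQuot

/-! ### Local frames, and continuity of the kernels of a family of surjections -/

section LocalSections

variable {B : Type*} [TopologicalSpace B] {q : ℕ} {E : B → Type*}
  [∀ b, AddCommGroup (E b)] [∀ b, Module ℂ (E b)] [∀ b, TopologicalSpace (E b)]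
  [TopologicalSpace (Bundle.TotalSpace (Fin q → ℂ) E)] [FiberBundle (Fin q → ℂ) E]
  [VectorBundle ℂ (Fin q → ℂ) E]

variable (E) in
/-- The sections of the preferred trivialization at `b₀`. -/
def localSection (b₀ : B) (v : Fin q → ℂ) (b : B) : E b :=
  (trivializationAt (Fin q → ℂ) E b₀).symmₗ ℂ b v

theorem localSection_eq {b₀ b : B} (hb : b ∈ locDomain E q b₀) (v : Fin q → ℂ) :
    localSection E b₀ v b = (locEquiv hb).symm v := by
  rw [localSection, Bundle.Trivialization.symmₗ_apply _ hb]
  rfl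

theorem continuousAt_localSection {b₀ b : B} (hb : b ∈ locDomain E q b₀) (v : Fin q → ℂ) :
    ContinuousAt (fun b =>
      (⟨b, localSection E b₀ v b⟩ : Bundle.TotalSpace (Fin q → ℂ) E)) b := by
  let e := trivializationAt (Fin q → ℂ) E b₀
  have hsymm : ContinuousAt (fun b' => e.toOpenPartialHomeomorph.symm (b', v)) b := by
    have h := e.toOpenPartialHomeomorph.symm.continuousAt (x := (b, v))
      (e.mem_target.2 hb)
    exact ContinuousAt.comp (f := fun b' => (b', v)) h (by fun_prop)
  refine hsymm.congr ?_
  filter_upwards [(isOpen_locDomain E b₀).mem_nhds hb] with b' hb'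
  rw [localSection, Bundle.Trivialization.symmₗ_apply _ hb']
  exact (e.mk_symm hb' v).symm

theorem linearIndependent_localSection {b₀ b : B} (hb : b ∈ locDomain E q b₀) :
    LinearIndependent ℂ fun i : Fin q => localSection E b₀ (Pi.single i 1) b := by
  simp only [localSection_eq hb]
  exact (Pi.linearIndependent_single_one (Fin q) ℂ).map' (locEquiv hb).symm.toLinearMap
    (LinearEquiv.ker _)

variable {Y : Type*} [TopologicalSpace Y] {p : Y → B}

/-- The kernels of a continuous family of linear surjections form a continuous family of points of
the Grassmannian. -/
theorem exists_kerMap (hp : Continuous p) {a : ∀ y, HInf →ₗ[ℂ] E (p y)}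
    (ha : ∀ w, Continuous (fun y => (⟨p y, a y w⟩ : Bundle.TotalSpace (Fin q → ℂ) E)))
    (hs : ∀ y, Function.Surjective (a y)) {n : ℕ}
    (hn : ∀ y, LinearMap.ker (trunc n) ≤ LinearMap.ker (a y)) :
    ∃ f : C(Y, GrInf q), ∀ y, (f y).sub = LinearMap.ker (a y) := by
  have hincl : ∀ y w, a y (incl n (trunc n w)) = a y w := by
    intro y w
    have := LinearMap.mem_ker.1 (hn y (LinearMap.mem_ker.2 (trunc_sub_incl_trunc (n := n) w)))
    rw [map_sub, sub_eq_zero] at this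
    exact this.symm
  -- In the trivialization at `b₀` the family becomes a family of surjections `ℍⁿ → ℂ^q`. Its
  -- kernels do not depend on `b₀`, so continuity at `y₀` may be checked with the one trivialization
  -- at `p y₀`.
  let A : ∀ (b₀ : B) (y : Y), p y ∈ locDomain E q b₀ → Epis q n := fun b₀ y hy =>
    ⟨LinearMap.toContinuousLinearMap ((locEquiv hy).toLinearMap ∘ₗ a y ∘ₗ inclLin n), by
      refine (locEquiv hy).surjective.comp fun v => ?_
      obtain ⟨w, rfl⟩ := hs y v
      exact ⟨trunc n w, hincl y w⟩⟩
  have hA : ∀ b₀ y hy, (stagePoint (A b₀ y hy)).sub = LinearMap.ker (a y) := by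
    intro b₀ y hy
    ext w
    rw [mem_stagePoint]
    change locEquiv hy (a y (incl n (trunc n w))) = 0 ↔ _
    rw [LinearEquiv.map_eq_zero_iff, hincl, LinearMap.mem_ker]
  let f : Y → GrInf q := fun y => stagePoint (A (p y) y (mem_locDomain E (p y)))
  have hf : ∀ b₀ y hy, f y = stagePoint (A b₀ y hy) := fun b₀ y hy =>
    GrInf.ext ((hA _ _ _).trans (hA _ _ _).symm)
  refine ⟨⟨f, continuous_iff_continuousAt.2 fun y₀ => ?_⟩, fun y => hA _ _ _⟩
  have hU : IsOpen (p ⁻¹' locDomain E q (p y₀)) := (isOpen_locDomain E _).preimage hp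
  refine ContinuousOn.continuousAt (s := p ⁻¹' locDomain E q (p y₀)) ?_
    (hU.mem_nhds (mem_locDomain E (p y₀)))
  rw [continuousOn_iff_continuous_domRestrict]
  have hres : Set.domRestrict (p ⁻¹' locDomain E q (p y₀)) f =
      fun y => stagePoint (A (p y₀) y.1 y.2) := funext fun y => hf _ _ y.2
  rw [hres]
  refine (continuous_stagePoint n).comp (Continuous.subtype_mk ?_ _)
  refine continuous_clm_apply.2 fun w => continuous_iff_continuousAt.2 fun y => ?_
  change ContinuousAt (fun y : p ⁻¹' locDomain E q (p y₀) =>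
    locEquiv y.2 (a y (incl n w))) y
  simp only [locEquiv_apply]
  have hsec : ContinuousAt (fun z : p ⁻¹' locDomain E q (p y₀) =>
      (⟨p z, a z (incl n w)⟩ : Bundle.TotalSpace (Fin q → ℂ) E)) y :=
    ((ha (incl n w)).comp continuous_subtype_val).continuousAt
  have hy : (⟨p y, a y (incl n w)⟩ : Bundle.TotalSpace (Fin q → ℂ) E) ∈
      (trivializationAt (Fin q → ℂ) E (p y₀)).source :=
    (trivializationAt (Fin q → ℂ) E (p y₀)).mem_source.2 y.2
  have htriv := ContinuousAt.comp (g := trivializationAt (Fin q → ℂ) E (p y₀))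
    (f := fun z : p ⁻¹' locDomain E q (p y₀) =>
      (⟨p z, a z (incl n w)⟩ : Bundle.TotalSpace (Fin q → ℂ) E))
    ((trivializationAt (Fin q → ℂ) E (p y₀)).continuousAt hy) hsec
  refine (continuous_snd.continuousAt.comp htriv).congr (Filter.Eventually.of_forall fun z => ?_)
  simp only [locCoord_apply z.2]
  rfl

end LocalSections

/-! ### Classification in terms of presentations -/

section Classification

variable {X : Type u} [TopologicalSpace X] {j : C(X, X)} {q : ℕ}

/-- A presentation of a quaternionic bundle `E` as the pullback along `f` of the universal quotient
bundle: compatible linear surjections `ℍ^∞ → E x` with kernels `f x`. -/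
structure IsPresentation (E : QuatBundle.{u, v} j q) (f : X → GrInf q)
    (a : ∀ x, HInf →ₗ[ℂ] E.fiber x) : Prop where
  surjective : ∀ x, Function.Surjective (a x)
  ker : ∀ x, LinearMap.ker (a x) = (f x).sub
  continuous_apply : ∀ w, Continuous fun x => (⟨x, a x w⟩ : E.Total)
  comm : ∀ x w, a (j x) (jInf w) = E.J x (a x w)

namespace IsPresentation

variable {E E' : QuatBundle.{u, v} j q} {f : X → GrInf q} {a : ∀ x, HInf →ₗ[ℂ] E.fiber x}
  {a' : ∀ x, HInf →ₗ[ℂ] E'.fiber x}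

/-- The isomorphism of the fibre of the universal quotient bundle with the fibre of `E`. -/
def equiv (h : IsPresentation E f a) (x : X) : (HInf ⧸ (f x).sub) ≃ₗ[ℂ] E.fiber x :=
  (Submodule.quotEquivOfEq _ _ (h.ker x).symm).trans
    (LinearMap.quotKerEquivOfSurjective (a x) (h.surjective x))

theorem equiv_mk (h : IsPresentation E f a) (x : X) (w : HInf) :
    h.equiv x (Submodule.Quotient.mk w) = a x w := rfl

theorem equiv_symm_apply (h : IsPresentation E f a) (x : X) (w : HInf) :
    (h.equiv x).symm (a x w) = Submodule.Quotient.mk w := by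
  rw [LinearEquiv.symm_apply_eq, h.equiv_mk]

/-- Locally a point of `E` is `a x` of a combination of fixed vectors with continuous coefficients;
its image is `a' x` of the same combination. -/
theorem continuous_equiv_symm_trans (h : IsPresentation E f a) (h' : IsPresentation E' f a') :
    Continuous fun p : E.Total =>
      (⟨p.1, h'.equiv p.1 ((h.equiv p.1).symm p.2)⟩ : E'.Total) := by
  refine continuous_iff_continuousAt.2 fun z₀ => ?_
  obtain ⟨w, c, hc, hce⟩ := exists_local_lift (t := fun z : E.Total => z) h.continuous_apply
    h.surjective (continuousAt_id (x := z₀))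
  have hp : ContinuousAt (fun z : E.Total => z.1) z₀ :=
    (FiberBundle.continuous_proj (Fin q → ℂ) E.fiber).continuousAt
  have hsum := continuousAt_sum_smul (E := E'.fiber) (p := fun z : E.Total => z.1)
    (s := fun i z => a' z.1 (w i)) (c := fun i z => c z i) hp
    (fun i => ContinuousAt.comp (f := fun z : E.Total => z.1)
      (h'.continuous_apply (w i)).continuousAt hp) (fun i => continuousAt_pi.1 hc i)
  refine hsum.congr (hce.mono fun z hz => ?_)
  refine congrArg (Bundle.TotalSpace.mk z.1) ?_
  rw [hz, h.equiv_symm_apply, h'.equiv_mk]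
  simp

/-- Two bundles presented by the same map are isomorphic. -/
def iso (h : IsPresentation E f a) (h' : IsPresentation E' f a') : QuatBundle.Iso E E' where
  e x := (h.equiv x).symm.trans (h'.equiv x)
  continuous_toFun := h.continuous_equiv_symm_trans h'
  continuous_invFun := h'.continuous_equiv_symm_trans h
  comm x w := by
    obtain ⟨w, rfl⟩ := h.surjective x w
    rw [← h.comm]
    simp only [LinearEquiv.trans_apply, h.equiv_symm_apply, h'.equiv_mk]
    exact h'.comm x w

/-- An isomorphism carries presentations to presentations. -/
theorem map_iso (h : IsPresentation E f a) (φ : QuatBundle.Iso E E') :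
    IsPresentation E' f fun x => (φ.e x).toLinearMap ∘ₗ a x where
  surjective x := (φ.e x).surjective.comp (h.surjective x)
  ker x := by rw [LinearEquiv.ker_comp, h.ker]
  continuous_apply w := φ.continuous_toFun.comp (h.continuous_apply w)
  comm x w := by
    simp only [LinearMap.comp_apply, LinearEquiv.coe_coe, h.comm, φ.comm]

/-- The finitely many vectors of a local lift lie in a single `ℍⁿ`, as the topology of `UnivQuot`
requires. -/
theorem isClassifiedBy {f : Z2Map j q} (h : IsPresentation E f.map a) : IsClassifiedBy E f := by
  refine ⟨fun x => (h.equiv x).symm, continuous_iff_continuousAt.2 fun z₀ => ?_, fun x w => ?_⟩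
  · obtain ⟨w, c, hc, hce⟩ := exists_local_lift (t := fun z : E.Total => z) h.continuous_apply
      h.surjective (continuousAt_id (x := z₀))
    obtain ⟨n, w', hw'⟩ := exists_incl_eq w
    have hp : ContinuousAt (fun z : E.Total => f.map z.1) z₀ :=
      (f.map.continuous.comp (FiberBundle.continuous_proj (Fin q → ℂ) E.fiber)).continuousAt
    refine (continuousAt_univQuot_sum (w := fun i _ => w' i) hp hc
      fun i => continuousAt_const).congr (hce.mono fun z hz => ?_)
    simp only [hw']
    rw [hz, h.equiv_symm_apply]
  · obtain ⟨w, rfl⟩ := h.surjective x w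
    rw [← h.comm, h.equiv_symm_apply, h.equiv_symm_apply, UnivQuot.conj_mk]
    exact UnivQuot.mk_eq_of_eq (f.isZ2Map x) _

end IsPresentation

/-- A bundle is classified by `f` iff it has a presentation with kernels given by `f`. -/
theorem isClassifiedBy_iff {E : QuatBundle.{u, v} j q} {f : Z2Map j q} :
    IsClassifiedBy E f ↔ ∃ a, IsPresentation E f.map a := by
  refine ⟨?_, fun ⟨a, h⟩ => h.isClassifiedBy⟩
  rintro ⟨Ψ, hΨ, hJ⟩
  refine ⟨fun x => (Ψ x).symm.toLinearMap ∘ₗ (f.map x).sub.mkQ, fun x =>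
    (Ψ x).symm.surjective.comp (Submodule.mkQ_surjective _), fun x => ?_, fun w => ?_,
    fun x w => ?_⟩
  · rw [LinearEquiv.ker_comp, Submodule.ker_mkQ]
  · refine continuous_iff_continuousAt.2 fun x₀ => ?_
    have hs := fun i : Fin q => continuousAt_localSection (mem_locDomain (q := q) E.fiber x₀)
      (Pi.single i 1)
    -- The pullback along the identity serves as a vector bundle model of the universal quotient.
    -- There `Ψ` carries a local frame of `E` to a continuous frame; the coordinates of the class of
    -- `w` in it are continuous, and they are also the coordinates of the required section of `E`.
    let g := ContinuousMap.id (GrInf q)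
    obtain ⟨c, hc, hce⟩ := exists_continuousAt_coords (E := PullFiber.{0, 0} g) (p := f.map)
      (y₀ := x₀)
      (s := fun i x => (pullEquiv g (f.map x)).symm
        (Ψ x (localSection E.fiber x₀ (Pi.single i 1) x)))
      (t := fun x => pullMk g (f.map x) w)
      (fun i => (UnivQuot.continuous_toPull.comp hΨ).continuousAt.comp (hs i))
      ((continuous_pullMk g w).comp f.map.continuous).continuousAt
      ((linearIndependent_localSection (mem_locDomain (q := q) E.fiber x₀)).map'
        ((Ψ x₀).trans (pullEquiv g (f.map x₀)).symm).toLinearMap (LinearEquiv.ker _))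
    refine (continuousAt_sum_smul (c := fun i x => c x i) continuousAt_id hs
      fun i => continuousAt_pi.1 hc i).congr (hce.mono fun x hx => ?_)
    refine congrArg (Bundle.TotalSpace.mk x) ((Ψ x).injective ?_)
    rw [LinearMap.comp_apply, LinearEquiv.coe_coe, LinearEquiv.apply_symm_apply]
    simp only [map_sum, map_smul]
    have hx' := congrArg (pullEquiv g (f.map x)) hx
    simp only [map_sum, map_smul, pullEquiv_pullMk] at hx'
    exact hx'.symm
  · rw [LinearMap.comp_apply, LinearEquiv.coe_coe, LinearEquiv.symm_apply_eq]
    have h := hJ x ((Ψ x).symm (Submodule.Quotient.mk w))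
    rw [LinearEquiv.apply_symm_apply, UnivQuot.conj_mk,
      ← UnivQuot.mk_eq_of_eq (f.isZ2Map x)] at h
    exact (eq_of_heq (UnivQuot.mk.inj h).2).symm

end Classification

section Constructions

variable {X : Type u} [TopologicalSpace X] {j : C(X, X)} {q : ℕ}

/-! ### Every `ℤ₂`-map classifies a bundle -/

theorem Z2Map.sub_le_comap (f : Z2Map j q) (x : X) :
    (f.map x).sub ≤ (f.map (j x)).sub.comap jInf := by
  rw [f.isZ2Map x]
  exact Submodule.le_comap_map _ _

/-- The quaternionic structure on the pullback of the universal quotient bundle. -/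
def pullJ (f : Z2Map j q) (x : X) :
    PullFiber.{u, v} f.map x →ₛₗ[starRingEnd ℂ] PullFiber.{u, v} f.map (j x) :=
  (pullEquiv f.map (j x)).symm.toLinearMap.comp
    ((Submodule.mapQ (f.map x).sub (f.map (j x)).sub jInf (f.sub_le_comap x)).comp
      (pullEquiv f.map x).toLinearMap)

theorem pullJ_pullMk (f : Z2Map j q) (x : X) (w : HInf) :
    pullJ.{u, v} f x (pullMk f.map x w) = pullMk f.map (j x) (jInf w) := rfl

/-- Antilinearity conjugates the coefficients of a local lift and replaces its vectors `w i` by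
`jInf (w i)`. -/
theorem continuous_pullJ (f : Z2Map j q) :
    Continuous fun z : Bundle.TotalSpace (Fin q → ℂ) (PullFiber.{u, v} f.map) =>
      (⟨j z.1, pullJ f z.1 z.2⟩ : Bundle.TotalSpace (Fin q → ℂ) (PullFiber.{u, v} f.map)) := by
  refine continuous_iff_continuousAt.2 fun z₀ => ?_
  obtain ⟨w, c, hc, hce⟩ := exists_local_lift
    (t := fun z : Bundle.TotalSpace (Fin q → ℂ) (PullFiber.{u, v} f.map) => z)
    (continuous_pullMk f.map) (pullMk_surjective f.map) (continuousAt_id (x := z₀))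
  have hp : Continuous fun z : Bundle.TotalSpace (Fin q → ℂ) (PullFiber.{u, v} f.map) =>
      j z.1 :=
    j.continuous.comp (FiberBundle.continuous_proj (Fin q → ℂ) (PullFiber.{u, v} f.map))
  have hs : ∀ i, ContinuousAt
      (fun z : Bundle.TotalSpace (Fin q → ℂ) (PullFiber.{u, v} f.map) =>
        (⟨j z.1, pullMk f.map (j z.1) (jInf (w i))⟩ :
          Bundle.TotalSpace (Fin q → ℂ) (PullFiber.{u, v} f.map))) z₀ :=
    fun i => ((continuous_pullMk f.map (jInf (w i))).comp hp).continuousAt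
  have hc' : ∀ i, ContinuousAt (fun z => conj (c z i)) z₀ := fun i =>
    Complex.continuous_conj.continuousAt.comp (continuousAt_pi.1 hc i)
  have h := continuousAt_sum_smul (E := PullFiber.{u, v} f.map) hp.continuousAt hs hc'
  refine h.congr (hce.mono fun z hz => ?_)
  have hz' : pullJ f z.1 z.2 = ∑ i, conj (c z i) • pullMk f.map (j z.1) (jInf (w i)) := by
    rw [hz, pullJ_pullMk]
    simp only [map_sum, map_smulₛₗ, RingHom.id_apply]
  exact congrArg (Bundle.TotalSpace.mk (j z.1)) hz'.symm

/-- The pullback of the universal quotient bundle along a `ℤ₂`-map. -/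
def pullBundle (hj : Function.Involutive j) (f : Z2Map j q) : QuatBundle.{u, v} j q where
  fiber := PullFiber.{u, v} f.map
  J := pullJ f
  continuous_J := continuous_pullJ f
  J_J x e := by
    obtain ⟨w, rfl⟩ := pullMk_surjective f.map x e
    rw [pullJ_pullMk, pullJ_pullMk, jInf_jInf, ← map_neg]
    exact congrArg (fun y => (⟨y, pullMk f.map y (-w)⟩ :
      Bundle.TotalSpace (Fin q → ℂ) (PullFiber.{u, v} f.map))) (hj x)

theorem isPresentation_pullBundle (hj : Function.Involutive j) (f : Z2Map j q) :
    IsPresentation (pullBundle.{u, v} hj f) f.map (pullMk f.map) where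
  surjective := pullMk_surjective f.map
  ker x := by
    ext w
    exact pullMk_eq_zero_iff f.map x
  continuous_apply := continuous_pullMk f.map
  comm _ _ := rfl

/-! ### `ℤ₂`-maps from compatible families of surjections -/

theorem totalSpace_eq_zero {E : X → Type*} [∀ x, Zero (E x)] {x x' : X} {e : E x}
    (h : (⟨x', 0⟩ : Bundle.TotalSpace (Fin q → ℂ) E) = ⟨x, e⟩) : e = 0 := by
  obtain rfl : x' = x := congrArg Bundle.TotalSpace.proj h
  exact (eq_of_heq (Bundle.TotalSpace.mk.inj h).2).symm

theorem QuatBundle.J_injective (E : QuatBundle.{u, v} j q) (x : X) :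
    Function.Injective (E.J x) := by
  refine (injective_iff_map_eq_zero (E.J x)).2 fun e he => ?_
  have h := E.J_J x e
  rw [he, map_zero] at h
  exact neg_eq_zero.1 (totalSpace_eq_zero h)

/-- The inverse of `jInf` is `-jInf`; injectivity of `E.J` gives the inclusion of the kernel at `j
x` in the conjugate of the kernel at `x`. -/
theorem isZ2Map_of_ker {E : QuatBundle.{u, v} j q} {f : C(X, GrInf q)}
    {a : ∀ x, HInf →ₗ[ℂ] E.fiber x} (hker : ∀ x, (f x).sub = LinearMap.ker (a x))
    (hcomm : ∀ x w, a (j x) (jInf w) = E.J x (a x w)) : IsZ2Map j f := by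
  intro x
  refine GrInf.ext ?_
  rw [hker]
  change _ = (f x).sub.map jInf
  rw [hker]
  ext w
  rw [Submodule.mem_map, LinearMap.mem_ker]
  constructor
  · intro hw
    have h : jInf (-jInf w) = w := by rw [map_neg, jInf_jInf, neg_neg]
    refine ⟨-jInf w, LinearMap.mem_ker.2 (E.J_injective x ?_), h⟩
    rw [← hcomm, h, hw, map_zero]
  · rintro ⟨w, hw, rfl⟩
    rw [hcomm, LinearMap.mem_ker.1 hw, map_zero]

/-- A compatible family of surjections of finite level presents `E`. -/
theorem exists_isPresentation {E : QuatBundle.{u, v} j q} {a : ∀ x, HInf →ₗ[ℂ] E.fiber x}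
    (ha : ∀ w, Continuous fun x => (⟨x, a x w⟩ : E.Total))
    (hs : ∀ x, Function.Surjective (a x)) {n : ℕ}
    (hn : ∀ x, LinearMap.ker (trunc n) ≤ LinearMap.ker (a x))
    (hcomm : ∀ x w, a (j x) (jInf w) = E.J x (a x w)) :
    ∃ f : Z2Map j q, IsPresentation E f.map a := by
  obtain ⟨f, hf⟩ := exists_kerMap continuous_id ha hs hn
  exact ⟨⟨f, isZ2Map_of_ker hf hcomm⟩, hs, fun x => (hf x).symm, ha, hcomm⟩

/-! ### Every bundle is classified by a `ℤ₂`-map -/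

theorem exists_mk_eq {E : X → Type*} {x : X} (p : Bundle.TotalSpace (Fin q → ℂ) E)
    (hp : p.1 = x) : ∃ e : E x, (⟨x, e⟩ : Bundle.TotalSpace (Fin q → ℂ) E) = p := by
  subst hp
  exact ⟨p.2, rfl⟩

/-- The image of a section under the quaternionic structure. -/
theorem QuatBundle.exists_conj_section (hj : Function.Involutive j) (E : QuatBundle.{u, v} j q)
    {s : ∀ x, E.fiber x} (hs : Continuous fun x => (⟨x, s x⟩ : E.Total)) :
    ∃ s' : ∀ x, E.fiber x, (Continuous fun x => (⟨x, s' x⟩ : E.Total)) ∧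
      (∀ x, E.J x (s x) = s' (j x)) ∧ ∀ x, E.J x (s' x) = -s (j x) := by
  -- The value at `x` is `J (s (j x))`, which lives over `j (j x)`; an equality in the total space
  -- moves it to the fibre over `x`.
  choose s' hs' using fun x => exists_mk_eq
    (⟨j (j x), E.J (j x) (s (j x))⟩ : E.Total) (hj x)
  have hmk : ∀ {x : X} {e e' : E.fiber x}, (⟨x, e⟩ : E.Total) = ⟨x, e'⟩ → e = e' :=
    fun h => eq_of_heq (Bundle.TotalSpace.mk.inj h).2
  let Jt : E.Total → E.Total := fun p => ⟨j p.1, E.J p.1 p.2⟩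
  refine ⟨s', ?_, fun x => hmk ?_, fun x => hmk ?_⟩
  · simp only [hs']
    exact E.continuous_J.comp (hs.comp j.continuous)
  · rw [hs']
    exact congrArg (fun y => Jt ⟨y, s y⟩) (hj x).symm
  · exact (congrArg Jt (hs' x)).trans (E.J_J (j x) (s (j x)))

theorem QuatBundle.exists_generating_sections [CompactSpace X] [T2Space X]
    (E : QuatBundle.{u, v} j q) :
    ∃ (n : ℕ) (s : Fin n → ∀ x, E.fiber x), (∀ k, Continuous fun x => (⟨x, s k x⟩ : E.Total)) ∧
      ∀ x, Submodule.span ℂ (Set.range fun k => s k x) = ⊤ := by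
  obtain ⟨ρ, hρ⟩ := PartitionOfUnity.exists_isSubordinate (ι := X) (s := Set.univ) isClosed_univ
    (fun x₀ => locDomain E.fiber q x₀) (fun x₀ => isOpen_locDomain E.fiber x₀)
    (fun x _ => Set.mem_iUnion.2 ⟨x, mem_locDomain E.fiber x⟩)
  -- Finitely many cut-off local frames suffice: where `ρ i` does not vanish, the `i`-th one still
  -- spans the fibre.
  obtain ⟨t, ht⟩ := isCompact_univ.elim_finite_subcover (fun i => {x : X | ρ i x ≠ 0})
    (fun i => isOpen_ne_fun (ρ i).continuous continuous_const)
    (fun x _ => Set.mem_iUnion.2 ((ρ.exists_pos (Set.mem_univ x)).imp fun i hi => hi.ne'))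
  let S : t × Fin q → ∀ x, E.fiber x := fun i x =>
    (ρ i.1 x : ℂ) • localSection E.fiber i.1 (Pi.single i.2 1) x
  have hS : ∀ i, Continuous fun x => (⟨x, S i x⟩ : E.Total) := by
    intro i
    refine continuous_iff_continuousAt.2 fun x => ?_
    by_cases hx : x ∈ tsupport (ρ i.1)
    · have h := continuousAt_sum_smul (ι := Unit) (p := fun x : X => x)
        (c := fun _ x => (ρ i.1 x : ℂ)) continuousAt_id
        (fun _ => continuousAt_localSection (hρ i.1 hx) (Pi.single i.2 1))
        (fun _ => (Complex.continuous_ofReal.comp (ρ i.1).continuous).continuousAt)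
      exact h.congr (Filter.Eventually.of_forall fun y =>
        congrArg (Bundle.TotalSpace.mk y) (Fintype.sum_unique _))
    · refine (Bundle.Trivialization.continuous_zeroSection ℂ (F := Fin q → ℂ)
        (E := E.fiber)).continuousAt.congr ?_
      filter_upwards [(isClosed_tsupport (ρ i.1)).isOpen_compl.mem_nhds hx] with y hy
      change _ = (⟨y, (ρ i.1 y : ℂ) • _⟩ : E.Total)
      rw [image_eq_zero_of_notMem_tsupport hy, Complex.ofReal_zero, zero_smul]
      rfl
  let σ := (Fintype.equivFin (t × Fin q)).symm
  refine ⟨_, fun k => S (σ k), fun k => hS _, fun x => ?_⟩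
  obtain ⟨i, hi, hxi⟩ : ∃ i ∈ t, ρ i x ≠ 0 := by simpa using ht (Set.mem_univ x)
  have hxU : x ∈ locDomain E.fiber q i := hρ i (subset_tsupport _ hxi)
  have hli := linearIndependent_localSection (E := E.fiber) hxU
  have : FiniteDimensional ℂ (E.fiber x) := (locEquiv hxU).symm.finiteDimensional
  have htop := hli.span_eq_top_of_card_eq_finrank' (by
    rw [finrank_fiber q E.fiber x, Fintype.card_fin])
  rw [eq_top_iff, ← htop, Submodule.span_le]
  rintro _ ⟨k, rfl⟩
  have hmem : S (⟨i, hi⟩, k) x ∈ Submodule.span ℂ (Set.range fun k => S (σ k) x) :=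
    Submodule.subset_span ⟨σ.symm (⟨i, hi⟩, k), by simp⟩
  have h := Submodule.smul_mem _ ((ρ i x : ℂ)⁻¹) hmem
  rwa [inv_smul_smul₀ (Complex.ofReal_ne_zero.2 hxi)] at h

/-- The linear map `(aₖ + bₖ j)ₖ ↦ ∑ aₖ sₖ + bₖ s'ₖ`. -/
def quatCombination {V : Type*} [AddCommGroup V] [Module ℂ V] {n : ℕ} (s s' : Fin n → V) :
    HInf →ₗ[ℂ] V where
  toFun w := ∑ k : Fin n, ((w k).1 • s k + (w k).2 • s' k)
  map_add' w w' := by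
    rw [← Finset.sum_add_distrib]
    refine Finset.sum_congr rfl fun k _ => ?_
    simp only [Finsupp.add_apply, Prod.fst_add, Prod.snd_add]
    module
  map_smul' c w := by
    rw [RingHom.id_apply, Finset.smul_sum]
    refine Finset.sum_congr rfl fun k _ => ?_
    simp only [Finsupp.smul_apply, Prod.smul_fst, Prod.smul_snd, smul_eq_mul]
    module

theorem quatCombination_apply {V : Type*} [AddCommGroup V] [Module ℂ V] {n : ℕ}
    (s s' : Fin n → V) (w : HInf) :
    quatCombination s s' w = ∑ k : Fin n, ((w k).1 • s k + (w k).2 • s' k) := rfl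

/-- The conjugate sections `s'` are images of `j` times the basis quaternions, which makes the
family equivariant; the `s` alone already make it surjective, and coordinates from `n` on go to
zero. -/
theorem QuatBundle.exists_classifying [CompactSpace X] [T2Space X] (hj : Function.Involutive j)
    (E : QuatBundle.{u, v} j q) : ∃ f : Z2Map j q, IsClassifiedBy E f := by
  obtain ⟨n, s, hs, hspan⟩ := E.exists_generating_sections
  choose s' hs' hJs hJs' using fun k => E.exists_conj_section hj (hs k)
  suffices h : ∃ f : Z2Map j q, IsPresentation E f.map fun x =>
      quatCombination (fun k => s k x) fun k => s' k x from
    h.imp fun _ hf => hf.isClassifiedBy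
  refine exists_isPresentation (n := n) ?_ ?_ ?_ ?_
  · intro w
    have h := continuous_sum_smul (E := E.fiber) (ι := Fin n ⊕ Fin n) (p := fun x : X => x)
      (s := Sum.elim s s') (c := fun i _ => Sum.elim (fun k : Fin n => (w k).1)
        (fun k : Fin n => (w k).2) i)
      continuous_id (fun i => by rcases i with k | k; exacts [hs k, hs' k])
      (fun i => continuous_const)
    simpa [quatCombination_apply, Finset.sum_add_distrib] using h
  · intro x
    rw [← LinearMap.range_eq_top, eq_top_iff, ← hspan x, Submodule.span_le]
    rintro _ ⟨k, rfl⟩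
    refine ⟨Finsupp.single (k : ℕ) (1, 0), ?_⟩
    rw [quatCombination_apply, Finset.sum_eq_single k]
    · simp
    · intro i _ hi
      rw [Finsupp.single_eq_of_ne fun h => hi (Fin.ext h)]
      simp
    · simp
  · intro x w hw
    have hw' : ∀ k : Fin n, w k = 0 := congrFun (LinearMap.mem_ker.1 hw)
    simp [quatCombination_apply, hw']
  · intro x w
    simp only [quatCombination_apply, map_sum, map_add, map_smulₛₗ, hJs, hJs']
    refine Finset.sum_congr rfl fun k _ => ?_
    have h : jInf w k = (-conj (w k).2, conj (w k).1) := rfl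
    rw [h]
    module

/-! ### Two maps that classify the same bundle are homotopic -/

/-- Dropping the first `N` coordinates. -/
def shift (N : ℕ) : HInf →ₗ[ℂ] HInf :=
  Finsupp.lcomapDomain (fun k => k + N) (add_left_injective N)

theorem shift_jInf (N : ℕ) (w : HInf) : shift N (jInf w) = jInf (shift N w) := by
  ext1 k; rfl

/-- Such a `w` is invisible to any map factoring through `ℍ^N`, while a map precomposed with `shift
N` sees all of `u`. -/
theorem exists_shift_eq (N : ℕ) (u : HInf) : ∃ w, shift N w = u ∧ trunc N w = 0 := by
  refine ⟨Finsupp.mapDomain (fun k => k + N) u, ?_, ?_⟩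
  · ext1 k
    exact Finsupp.mapDomain_apply (add_left_injective N) u k
  · refine trunc_eq_zero_iff.2 fun k hk => Finsupp.mapDomain_of_notMem_range u k ?_
    rintro ⟨i, hi⟩
    have : i + N = k := hi
    omega

theorem trunc_shift {M N : ℕ} {w : HInf} (hw : trunc (M + N) w = 0) : trunc M (shift N w) = 0 :=
  trunc_eq_zero_iff.2 fun k hk => trunc_eq_zero_iff.1 hw (k + N) (by omega)

/-- The homotopy is the kernel of `(1 - t) a + t (b ∘ shift N)`. At `t = 0` it is onto because `a`
is; for `t ≠ 0` vectors supported beyond `N` are killed by `a` and already reach every element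
through `b`. All maps factor through `ℍ^(M + N)`, as shifting uses `N` more coordinates. -/
theorem isPresentation_homotopic_shift {E : QuatBundle.{u, v} j q} {f g g' : Z2Map j q}
    {a b : ∀ x, HInf →ₗ[ℂ] E.fiber x} (ha : IsPresentation E f.map a)
    (hb : IsPresentation E g.map b) {M N : ℕ}
    (haN : ∀ x, LinearMap.ker (trunc N) ≤ LinearMap.ker (a x))
    (hbM : ∀ x, LinearMap.ker (trunc M) ≤ LinearMap.ker (b x))
    (hg' : IsPresentation E g'.map fun x => b x ∘ₗ shift N) :
    ContinuousMap.HomotopicWith f.map g'.map (IsZ2Map j) := by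
  let A : ∀ y : unitInterval × X, HInf →ₗ[ℂ] E.fiber y.2 := fun y =>
    ((1 - (y.1 : ℝ) : ℝ) : ℂ) • a y.2 + ((y.1 : ℝ) : ℂ) • (b y.2 ∘ₗ shift N)
  have hA : ∀ t x w, A (t, x) w =
      ((1 - (t : ℝ) : ℝ) : ℂ) • a x w + ((t : ℝ) : ℂ) • b x (shift N w) := fun _ _ _ => rfl
  have hcont : ∀ w, Continuous fun y => (⟨y.2, A y w⟩ : E.Total) := by
    intro w
    have h := continuous_sum_smul (E := E.fiber) (ι := Fin 2)
      (p := fun y : unitInterval × X => y.2)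
      (s := ![fun y => a y.2 w, fun y => b y.2 (shift N w)])
      (c := ![fun y => ((1 - (y.1 : ℝ) : ℝ) : ℂ), fun y => ((y.1 : ℝ) : ℂ)])
      continuous_snd
      (fun i => by
        fin_cases i
        · exact (ha.continuous_apply w).comp continuous_snd
        · exact (hb.continuous_apply (shift N w)).comp continuous_snd)
      (fun i => by
        fin_cases i
        · exact Complex.continuous_ofReal.comp
            (continuous_const.sub (continuous_subtype_val.comp continuous_fst))
        · exact Complex.continuous_ofReal.comp (continuous_subtype_val.comp continuous_fst))
    exact h.congr fun y => congrArg (Bundle.TotalSpace.mk y.2) (Fin.sum_univ_two _)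
  have hsurj : ∀ y, Function.Surjective (A y) := by
    rintro ⟨t, x⟩ e
    by_cases ht : (t : ℝ) = 0
    · obtain ⟨w, rfl⟩ := ha.surjective x e
      exact ⟨w, by simp [hA, ht]⟩
    · obtain ⟨u, hu⟩ := hb.surjective x (((t : ℝ) : ℂ)⁻¹ • e)
      obtain ⟨w, rfl, hw⟩ := exists_shift_eq N u
      refine ⟨w, ?_⟩
      rw [hA, hu, LinearMap.mem_ker.1 (haN x (LinearMap.mem_ker.2 hw)), smul_zero, zero_add,
        smul_inv_smul₀ (Complex.ofReal_ne_zero.2 ht)]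
  have hker : ∀ y, LinearMap.ker (trunc (M + N)) ≤ LinearMap.ker (A y) := by
    rintro ⟨t, x⟩ w hw
    rw [LinearMap.mem_ker] at hw ⊢
    rw [hA, LinearMap.mem_ker.1 (haN x (ker_trunc_antitone (Nat.le_add_left N M) hw)),
      LinearMap.mem_ker.1 (hbM x (LinearMap.mem_ker.2 (trunc_shift hw))), smul_zero, smul_zero,
      add_zero]
  obtain ⟨F, hF⟩ := exists_kerMap continuous_snd hcont hsurj hker
  refine ⟨{ toFun := F, map_zero_left := fun x => ?_, map_one_left := fun x => ?_,
            continuous_toFun := F.continuous, prop' := fun t => ?_ }⟩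
  · refine GrInf.ext ((hF _).trans ?_)
    rw [← ha.ker x]
    congr 1
    refine LinearMap.ext fun w => ?_
    simp [hA]
  · refine GrInf.ext ((hF _).trans ?_)
    rw [← hg'.ker x]
    congr 1
    refine LinearMap.ext fun w => ?_
    simp [hA]
  -- The coefficients are real, so they commute with the antilinear structures.
  · refine isZ2Map_of_ker (E := E) (a := fun x => A (t, x)) (fun x => hF (t, x)) fun x w => ?_
    rw [hA, hA, shift_jInf, ha.comm, hb.comm, map_add, map_smulₛₗ, map_smulₛₗ, Complex.conj_ofReal,
      Complex.conj_ofReal]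

theorem IsPresentation.exists_bound [CompactSpace X] {E : QuatBundle.{u, v} j q} {f : Z2Map j q}
    {a : ∀ x, HInf →ₗ[ℂ] E.fiber x} (h : IsPresentation E f.map a) :
    ∃ N, ∀ x, LinearMap.ker (trunc N) ≤ LinearMap.ker (a x) := by
  obtain ⟨N, hN⟩ := exists_ker_trunc_le f.map
  exact ⟨N, fun x => (h.ker x).symm ▸ hN x⟩

/-- Both maps are joined to the kernel map `g'` of the shifted `b`; for `g` the homotopy lemma is
used with `a = b`. -/
theorem IsClassifiedBy.homotopic [CompactSpace X] {E : QuatBundle.{u, v} j q} {f g : Z2Map j q}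
    (hf : IsClassifiedBy E f) (hg : IsClassifiedBy E g) :
    ContinuousMap.HomotopicWith f.map g.map (IsZ2Map j) := by
  obtain ⟨a, ha⟩ := isClassifiedBy_iff.1 hf
  obtain ⟨b, hb⟩ := isClassifiedBy_iff.1 hg
  obtain ⟨N₁, haN⟩ := ha.exists_bound
  obtain ⟨N₂, hbN⟩ := hb.exists_bound
  let N := max N₁ N₂
  replace haN := fun x => (ker_trunc_antitone (le_max_left N₁ N₂)).trans (haN x)
  replace hbN := fun x => (ker_trunc_antitone (le_max_right N₁ N₂)).trans (hbN x)
  obtain ⟨g', hg'⟩ := exists_isPresentation (E := E) (a := fun x => b x ∘ₗ shift N) (n := N + N)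
    (fun w => hb.continuous_apply (shift N w))
    (fun x => (hb.surjective x).comp fun u => (exists_shift_eq N u).imp fun _ h => h.1)
    (fun x w hw => hbN x (LinearMap.mem_ker.2 (trunc_shift (LinearMap.mem_ker.1 hw))))
    (fun x w => by rw [LinearMap.comp_apply, shift_jInf, hb.comm]; rfl)
  exact (isPresentation_homotopic_shift ha hb haN hbN hg').trans
    (isPresentation_homotopic_shift hb hb hbN hbN hg').symm

end Constructions

/-! ### Equivariant splittings and homotopy invariance -/

section HomotopyInvariance

variable {X : Type u} [TopologicalSpace X] {j : C(X, X)} {q : ℕ}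

/-- The map `L : ℍ^∞ → ℍᴺ` factors through `a : ℍ^∞ → V` as a section of `a`. -/
structure IsLift {V : Type*} [AddCommGroup V] [Module ℂ V] (a : HInf →ₗ[ℂ] V) {N : ℕ}
    (L : HInf →ₗ[ℂ] (Fin N → H)) : Prop where
  apply_incl : ∀ w, a (incl N (L w)) = a w
  ker_le : LinearMap.ker a ≤ LinearMap.ker L

/-- Convexity lets local splittings be glued by a partition of unity. They are viewed as bare
functions because continuity into a function space is continuity at each vector. -/
theorem convex_setOf_isLift {V : Type*} [AddCommGroup V] [Module ℂ V] (a : HInf →ₗ[ℂ] V) (N : ℕ) :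
    Convex ℝ {P : HInf → Fin N → H | ∃ L : HInf →ₗ[ℂ] (Fin N → H), ⇑L = P ∧ IsLift a L} := by
  rintro _ ⟨L, rfl, hL⟩ _ ⟨L', rfl, hL'⟩ α β - - hαβ
  refine ⟨(α : ℂ) • L + (β : ℂ) • L', ?_, fun w => ?_, fun w hw => ?_⟩
  · ext w k <;> simp
  · rw [LinearMap.add_apply, LinearMap.smul_apply, LinearMap.smul_apply, ← inclLin_apply, map_add,
      map_smul, map_smul, inclLin_apply, inclLin_apply, map_add, map_smul, map_smul,
      hL.apply_incl, hL'.apply_incl, ← add_smul]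
    rw [← Complex.ofReal_add, hαβ, Complex.ofReal_one, one_smul]
  · rw [LinearMap.mem_ker, LinearMap.add_apply, LinearMap.smul_apply, LinearMap.smul_apply,
      LinearMap.mem_ker.1 (hL.ker_le hw), LinearMap.mem_ker.1 (hL'.ker_le hw)]
    simp

/-- A presentation of a quaternionic bundle splits continuously and equivariantly. -/
theorem IsPresentation.exists_isLift [CompactSpace X] [T2Space X] (hj : Function.Involutive j)
    {E : QuatBundle.{u, v} j q} {f : Z2Map j q} {a : ∀ x, HInf →ₗ[ℂ] E.fiber x}
    (h : IsPresentation E f.map a) :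
    ∃ (N : ℕ) (L : X → HInf →ₗ[ℂ] (Fin N → H)), (∀ x, IsLift (a x) (L x)) ∧
      (∀ w, Continuous fun x => L x w) ∧ ∀ x w, L (j x) (jInf w) = jFin N (L x w) := by
  obtain ⟨N, hN⟩ := h.exists_bound
  have htrunc : ∀ x w, a x (incl N (trunc N w)) = a x w := by
    intro x w
    have h0 := LinearMap.mem_ker.1
      (hN x (LinearMap.mem_ker.2 (trunc_sub_incl_trunc (n := N) w)))
    rw [map_sub, sub_eq_zero] at h0
    exact h0.symm
  obtain ⟨P, hP⟩ := exists_continuous_forall_mem_convex_of_local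
    (t := fun x => {P : HInf → Fin N → H | ∃ L : HInf →ₗ[ℂ] (Fin N → H), ⇑L = P ∧ IsLift (a x) L})
    (fun x => convex_setOf_isLift (a x) N) (by
      intro x₀
      obtain ⟨c, hc⟩ := exists_mem_frameSet (f.map x₀)
      -- Near `x₀` the splitting sends `w` to the combination of the truncated frame vectors with
      -- the coordinates of `w` as coefficients.
      refine ⟨f.map ⁻¹' frameSet c,
        ((isOpen_frameSet c).preimage f.map.continuous).mem_nhds hc,
        fun x w => ∑ i, frameCoord c w (f.map x) i • trunc N (c i), ?_, fun x hx => ?_⟩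
      · refine continuousOn_pi.2 fun w => continuousOn_finsetSum _ fun i _ => ?_
        have hcoord : ContinuousOn (fun x => frameCoord c w (f.map x)) (f.map ⁻¹' frameSet c) :=
          ContinuousOn.comp (t := frameSet c) (continuousOn_frameCoord c w)
            f.map.continuous.continuousOn fun x hx => hx
        exact (continuousOn_pi.1 hcoord i).smul continuousOn_const
      · refine ⟨∑ i, (LinearMap.proj i ∘ₗ frameLin c (f.map x) ∘ₗ (f.map x).sub.mkQ).smulRight
          (trunc N (c i)), ?_, fun w => ?_, fun w hw => ?_⟩
        · funext w
          simp [frameCoord]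
        · have hw : (Submodule.Quotient.mk w : HInf ⧸ (f.map x).sub) =
              ∑ i, frameCoord c w (f.map x) i • Submodule.Quotient.mk (c i) := by
            rw [frameCoord_of_mem hx, ← frameEquiv_symm_apply hx, LinearEquiv.symm_apply_apply]
          have hw' := congrArg (h.equiv x) hw
          simp only [map_sum, map_smul, h.equiv_mk] at hw'
          rw [hw']
          simp only [LinearMap.sum_apply, LinearMap.smulRight_apply, ← inclLin_apply, map_sum,
            map_smul]
          simp only [inclLin_apply, htrunc]
          rfl
        · rw [h.ker] at hw
          have hw0 : (f.map x).sub.mkQ w = 0 := (Submodule.Quotient.mk_eq_zero _).2 hw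
          rw [LinearMap.mem_ker, LinearMap.sum_apply]
          refine Finset.sum_eq_zero fun i _ => ?_
          rw [LinearMap.smulRight_apply, LinearMap.comp_apply, LinearMap.comp_apply, hw0, map_zero,
            map_zero, zero_smul])
  choose L hLP hL using hP
  have hLc : ∀ w, Continuous fun x => L x w := by
    intro w
    simp only [hLP]
    exact (_root_.continuous_apply w).comp P.continuous
  -- This is the average over the `ℤ₂`-action: the minus sign comes from `j⁻¹ = -j`.
  refine ⟨N, fun x => (2⁻¹ : ℂ) • (L x - (jFin N).comp ((L (j x)).comp jInf)),
    fun x => ⟨fun w => ?_, fun w hw => ?_⟩, fun w => ?_, fun x w => ?_⟩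
  · have h1 : a x (incl N (jFin N (L (j x) (jInf w)))) = -a x w := by
      apply E.J_injective x
      rw [← h.comm, incl_jFin, jInf_jInf, map_neg, (hL (j x)).apply_incl, h.comm, map_neg]
    change a x (incl N ((2⁻¹ : ℂ) • (L x w - jFin N (L (j x) (jInf w))))) = _
    rw [← inclLin_apply, map_smul, map_sub, inclLin_apply, inclLin_apply, map_smul, map_sub,
      (hL x).apply_incl, h1]
    module
  · have h1 : L x w = 0 := (hL x).ker_le hw
    have h2 : L (j x) (jInf w) = 0 := (hL (j x)).ker_le (by
      rw [LinearMap.mem_ker, h.comm, LinearMap.mem_ker.1 hw, map_zero])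
    change (2⁻¹ : ℂ) • (L x w - jFin N (L (j x) (jInf w))) = 0
    rw [h1, h2, map_zero, sub_zero, smul_zero]
  · have hJ : Continuous (jFin N) := by
      refine continuous_pi fun k => ?_
      have hJH : Continuous jH :=
        ((Complex.continuous_conj.comp continuous_snd).neg).prodMk
          (Complex.continuous_conj.comp continuous_fst)
      exact hJH.comp (_root_.continuous_apply k)
    exact ((hLc w).sub (hJ.comp ((hLc (jInf w)).comp j.continuous))).const_smul (2⁻¹ : ℂ)
  · change (2⁻¹ : ℂ) • (L (j x) (jInf w) - jFin N (L (j (j x)) (jInf (jInf w)))) =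
      jFin N ((2⁻¹ : ℂ) • (L x w - jFin N (L (j x) (jInf w))))
    rw [hj x, jInf_jInf, map_neg, map_neg, map_smulₛₗ, map_sub, jFin_jFin, sub_neg_eq_add,
      sub_neg_eq_add, add_comm]
    congr 1
    rw [map_inv₀, map_ofNat]

/-- The image of a continuous splitting remains complementary to the kernels under small
deformations of the latter. -/
theorem IsPresentation.eventually_ker [CompactSpace X] {E : QuatBundle.{u, v} j q}
    {f : Z2Map j q} {a : ∀ x, HInf →ₗ[ℂ] E.fiber x} (h : IsPresentation E f.map a) {N : ℕ}
    {L : X → HInf →ₗ[ℂ] (Fin N → H)} (hL : ∀ x, IsLift (a x) (L x))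
    (hLc : ∀ w, Continuous fun x => L x w) {T : Type*} [TopologicalSpace T]
    (F : C(T × X, GrInf q)) {t₀ : T} (hF : ∀ x, F (t₀, x) = f.map x) :
    ∀ᶠ t in 𝓝 t₀, ∀ x ∈ Set.univ, ∀ w, incl N (L x w) ∈ (F (t, x)).sub → a x w = 0 := by
  -- Compactness of `X` reduces the claim to a neighbourhood of each `(t₀, x₀)`. There the lifted
  -- frame vectors stay independent modulo `F`, an open condition.
  refine isCompact_univ.eventually_forall_of_forall_eventually fun x₀ _ => ?_
  obtain ⟨c, hc⟩ := exists_mem_frameSet (f.map x₀)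
  have hli₀ : LinearIndependent ℂ fun i => pullMk.{_, 0} F (t₀, x₀) (incl N (L x₀ (c i))) := by
    refine Fintype.linearIndependent_iff.2 fun μ hμ => ?_
    have h0 : (Submodule.Quotient.mk (∑ i, μ i • c i) : HInf ⧸ (f.map x₀).sub) = 0 := by
      rw [Submodule.Quotient.mk_eq_zero, ← h.ker, LinearMap.mem_ker, ← (hL x₀).apply_incl,
        ← LinearMap.mem_ker, h.ker, ← hF, ← pullMk_eq_zero_iff.{_, 0} F]
      refine Eq.trans ?_ hμ
      simp only [← inclLin_apply, map_sum, map_smul]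
    refine Fintype.linearIndependent_iff.1 hc μ ?_
    refine Eq.trans ?_ h0
    simp only [← Submodule.mkQ_apply, map_sum, map_smul]
  have hsec : ∀ i, Continuous fun y : T × X =>
      (⟨y, pullMk.{_, 0} F y (incl N (L y.2 (c i)))⟩ :
        Bundle.TotalSpace (Fin q → ℂ) (PullFiber.{_, 0} F)) := fun i =>
    continuous_family_incl (continuous_pullMk F) ((hLc (c i)).comp continuous_snd)
  have hev := eventually_linearIndependent (E := PullFiber.{_, 0} F) (p := fun y : T × X => y)
    (y₀ := (t₀, x₀)) continuousAt_id (fun i => (hsec i).continuousAt) hli₀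
  have hfr : ∀ᶠ y : T × X in 𝓝 (t₀, x₀), f.map y.2 ∈ frameSet c :=
    (f.map.continuous.comp continuous_snd).continuousAt
      ((isOpen_frameSet c).mem_nhds hc)
  filter_upwards [hev, hfr] with ⟨t, x⟩ hli hx w hw
  have hw' : (Submodule.Quotient.mk w : HInf ⧸ (f.map x).sub) =
      ∑ i, frameCoord c w (f.map x) i • Submodule.Quotient.mk (c i) := by
    rw [frameCoord_of_mem hx, ← frameEquiv_symm_apply hx, LinearEquiv.symm_apply_apply]
  have haw := congrArg (h.equiv x) hw'
  simp only [map_sum, map_smul, h.equiv_mk] at haw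
  -- As `L x` vanishes on the kernel of `a x`, it obeys every linear relation that holds in the
  -- fibre.
  have hLw : L x w = ∑ i, frameCoord c w (f.map x) i • L x (c i) := by
    have h0 : L x (w - ∑ i, frameCoord c w (f.map x) i • c i) = 0 := (hL x).ker_le (by
      rw [LinearMap.mem_ker, map_sub, haw]
      simp)
    rw [map_sub, sub_eq_zero] at h0
    rw [h0]
    simp
  have hμ : ∑ i, frameCoord c w (f.map x) i • pullMk.{_, 0} F (t, x) (incl N (L x (c i))) = 0 := by
    rw [← pullMk_eq_zero_iff.{_, 0} F, hLw] at hw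
    refine Eq.trans ?_ hw
    simp only [← inclLin_apply, map_sum, map_smul]
  have hz := Fintype.linearIndependent_iff.1 hli _ hμ
  rw [haw]
  exact Finset.sum_eq_zero fun i _ => by rw [hz i, zero_smul]

/-- A map whose values are complementary to the image of an equivariant splitting classifies the
same bundle. -/
theorem IsPresentation.isClassifiedBy_of_isLift {E : QuatBundle.{u, v} j q}
    {f g : Z2Map j q} {a : ∀ x, HInf →ₗ[ℂ] E.fiber x} (h : IsPresentation E f.map a) {N : ℕ}
    {L : X → HInf →ₗ[ℂ] (Fin N → H)} (hL : ∀ x, IsLift (a x) (L x))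
    (hLc : ∀ w, Continuous fun x => L x w)
    (hLj : ∀ x w, L (j x) (jInf w) = jFin N (L x w))
    (hg : ∀ x w, incl N (L x w) ∈ (g.map x).sub → a x w = 0) : IsClassifiedBy E g := by
  have hle : ∀ x, (f.map x).sub ≤ (g.map x).sub.comap (inclLin N ∘ₗ L x) := by
    intro x w hw
    rw [← h.ker] at hw
    rw [Submodule.mem_comap, LinearMap.comp_apply, LinearMap.mem_ker.1 ((hL x).ker_le hw), map_zero]
    exact Submodule.zero_mem _
  -- The splitting followed by the projection modulo `g x` descends to the fibre of `E`. Hypothesis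
  -- `hg` is its injectivity, and equality of ranks makes it an isomorphism.
  let φ : ∀ x, E.fiber x →ₗ[ℂ] (HInf ⧸ (g.map x).sub) := fun x =>
    Submodule.mapQ (f.map x).sub (g.map x).sub (inclLin N ∘ₗ L x) (hle x) ∘ₗ
      (h.equiv x).symm.toLinearMap
  have hφ : ∀ x w, φ x (a x w) = Submodule.Quotient.mk (incl N (L x w)) := by
    intro x w
    change Submodule.mapQ _ _ _ (hle x) ((h.equiv x).symm (a x w)) = _
    rw [h.equiv_symm_apply]
    rfl
  have hinj : ∀ x, Function.Injective (φ x) := by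
    intro x
    refine (injective_iff_map_eq_zero (φ x)).2 fun e he => ?_
    obtain ⟨w, rfl⟩ := h.surjective x e
    rw [hφ, Submodule.Quotient.mk_eq_zero] at he
    exact hg x w he
  have hfin : ∀ x, FiniteDimensional ℂ (E.fiber x) := fun x =>
    (locEquiv (mem_locDomain (q := q) E.fiber x)).symm.finiteDimensional
  let Ψ : ∀ x, E.fiber x ≃ₗ[ℂ] (HInf ⧸ (g.map x).sub) := fun x =>
    LinearEquiv.ofBijective (φ x) ⟨hinj x,
      (LinearMap.injective_iff_surjective_of_finrank_eq_finrank
        ((finrank_fiber q E.fiber x).trans (finrank_quotient _).symm)).1 (hinj x)⟩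
  have hΨ : ∀ x w, Ψ x (a x w) = Submodule.Quotient.mk (incl N (L x w)) := hφ
  refine ⟨Ψ, continuous_iff_continuousAt.2 fun z₀ => ?_, fun x w => ?_⟩
  · obtain ⟨w, c, hc, hce⟩ := exists_local_lift (t := fun z : E.Total => z) h.continuous_apply
      h.surjective (continuousAt_id (x := z₀))
    have hp : Continuous fun z : E.Total => z.1 :=
      FiberBundle.continuous_proj (Fin q → ℂ) E.fiber
    refine (continuousAt_univQuot_sum (w := fun i (z : E.Total) => L z.1 (w i))
      (g.map.continuous.comp hp).continuousAt hc
      fun i => ((hLc (w i)).comp hp).continuousAt).congr (hce.mono fun z hz => ?_)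
    change (⟨g.map z.1, _⟩ : UnivQuot q) = ⟨g.map z.1, Ψ z.1 z.2⟩
    rw [hz, hΨ]
    simp only [← inclLin_apply, map_sum, map_smul]
  · obtain ⟨w, rfl⟩ := h.surjective x w
    rw [← h.comm, hΨ, hΨ, UnivQuot.conj_mk, hLj, incl_jFin]
    exact UnivQuot.mk_eq_of_eq (g.isZ2Map x) _

theorem Z2Map.eq_of_map_eq {f g : Z2Map j q} (h : f.map = g.map) : f = g := by
  cases f
  cases g
  cases h
  rfl

/-- Homotopic maps classify the same bundles. -/
theorem IsClassifiedBy.of_homotopic [CompactSpace X] [T2Space X] (hj : Function.Involutive j)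
    {E : QuatBundle.{u, v} j q} {f g : Z2Map j q} (hf : IsClassifiedBy E f)
    (hfg : ContinuousMap.HomotopicWith f.map g.map (IsZ2Map j)) : IsClassifiedBy E g := by
  obtain ⟨F⟩ := hfg
  let Ft : unitInterval → Z2Map j q := fun t => ⟨_, F.prop' t⟩
  have hFt : ∀ t x, (Ft t).map x = F (t, x) := fun _ _ => rfl
  have hloc : ∀ (E : QuatBundle.{u, v} j q) (t : unitInterval), IsClassifiedBy E (Ft t) →
      ∀ᶠ s in 𝓝 t, IsClassifiedBy E (Ft s) := by
    intro E t ht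
    obtain ⟨a, ha⟩ := isClassifiedBy_iff.1 ht
    obtain ⟨N, L, hL, hLc, hLj⟩ := ha.exists_isLift hj
    filter_upwards [ha.eventually_ker hL hLc F.toContinuousMap (fun x => rfl)] with s hs
    exact ha.isClassifiedBy_of_isLift hL hLc hLj fun x w => hs x (Set.mem_univ x) w
  have hclopen : IsClopen {t | IsClassifiedBy E (Ft t)} := by
    refine ⟨isOpen_compl_iff.1 (isOpen_iff_mem_nhds.2 fun t ht => ?_),
      isOpen_iff_mem_nhds.2 fun t ht => hloc E t ht⟩
    -- For the complement: the pullback along `Ft t` is classified by all nearby `Ft s`. If such an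
    -- `Ft s` classified `E` as well, `E` would be isomorphic to that pullback and hence classified
    -- by `Ft t`.
    have hE' := isPresentation_pullBundle.{u, v} hj (Ft t)
    filter_upwards [hloc _ t hE'.isClassifiedBy] with s hs hs'
    obtain ⟨a, ha⟩ := isClassifiedBy_iff.1 hs
    obtain ⟨b, hb⟩ := isClassifiedBy_iff.1 hs'
    exact ht (hE'.map_iso (ha.iso hb)).isClassifiedBy
  have h0 : Ft 0 = f :=
    Z2Map.eq_of_map_eq (ContinuousMap.ext fun x => F.map_zero_left x)
  have h1 : Ft 1 = g :=
    Z2Map.eq_of_map_eq (ContinuousMap.ext fun x => F.map_one_left x)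
  have huniv := hclopen.eq_univ ⟨0, by rw [Set.mem_ofPred_eq, h0]; exact hf⟩
  have h : (1 : unitInterval) ∈ {t | IsClassifiedBy E (Ft t)} := huniv ▸ Set.mem_univ _
  rw [← h1]
  exact h

end HomotopyInvariance

end Quaternionic

end

theorem theorem11p2 {X : Type u} [TopologicalSpace X] [CompactSpace X] [T2Space X]
    (j : C(X, X)) (hj : Function.Involutive j) (q : ℕ) :
    ∃ Φ : Quaternionic.Z2HomotopyClasses j q ≃ Quaternionic.QuatBundleClasses.{u, v} j q,
      ∀ (f : Quaternionic.Z2Map j q) (E : Quaternionic.QuatBundle.{u, v} j q),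
        Φ (Quotient.mk _ f) = Quotient.mk _ E ↔ Quaternionic.IsClassifiedBy E f := by
  open Quaternionic in
  have hpull : ∀ f : Z2Map j q, IsClassifiedBy (pullBundle.{u, v} hj f) f := fun f =>
    (isPresentation_pullBundle hj f).isClassifiedBy
  have hiso : ∀ {f : Z2Map j q} {E E' : QuatBundle.{u, v} j q}, IsClassifiedBy E f →
      IsClassifiedBy E' f → E ≈ E' := by
    intro f E E' h h'
    obtain ⟨a, ha⟩ := isClassifiedBy_iff.1 h
    obtain ⟨b, hb⟩ := isClassifiedBy_iff.1 h'
    exact ⟨ha.iso hb⟩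
  have hmap : ∀ {f : Z2Map j q} {E E' : QuatBundle.{u, v} j q}, IsClassifiedBy E f →
      E ≈ E' → IsClassifiedBy E' f := by
    rintro f E E' h ⟨φ⟩
    obtain ⟨a, ha⟩ := isClassifiedBy_iff.1 h
    exact (ha.map_iso φ).isClassifiedBy
  let Φ : Z2HomotopyClasses j q → QuatBundleClasses.{u, v} j q :=
    Quotient.map (pullBundle.{u, v} hj) fun f g hfg =>
      hiso ((hpull f).of_homotopic hj hfg) (hpull g)
  have hΦ : ∀ (f : Z2Map j q) (E : QuatBundle.{u, v} j q),
      Φ (Quotient.mk _ f) = Quotient.mk _ E ↔ IsClassifiedBy E f := fun f E =>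
    ⟨fun h => hmap (hpull f) (Quotient.exact h), fun h => Quotient.sound (hiso (hpull f) h)⟩
  refine ⟨Equiv.ofBijective Φ ⟨?_, ?_⟩, hΦ⟩
  · rintro ⟨f⟩ ⟨g⟩ hfg
    -- Equal images mean that the pullback along `g` is classified by both `f` and `g`.
    have hg : IsClassifiedBy (pullBundle.{u, v} hj g) f := (hΦ f _).1 hfg
    exact Quotient.sound (hg.homotopic (hpull g))
  · rintro ⟨E⟩
    obtain ⟨f, hf⟩ := E.exists_classifying hj
    exact ⟨Quotient.mk _ f, (hΦ f E).2 hf⟩
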